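/- **Setting.** A repeat-accumulate code has $k\ge 1$ information bits $u_1,\dots,u_k$; bit $t$ is repeated $q_t\ge 1$ times, the resulting block of $n=\sum_t q_t$ bits is permuted by an interleaver $\pi$ (so that bit $t$ occupies a set of positions $X_t$, $|X_t|=q_t$) and fed into an accumulator, whose output at time $i$, the mod-2 sum of its inputs up to time $i$, is the codeword bit $x_i$. The code is a regular RA($q$) code if $q_t=q$ for all $t$, so that $n=qk$. The codeword is sent over an MBIOS channel (memoryless, binary-input, output-symmetric) with transition law $P(\tilde y\mid x)$; $\gamma_i=\ln\frac{P(\tilde y_i\mid 0)}{P(\tilde y_i\mid 1)}\in[-\infty,+\infty]$ is the log-likelihood ratio (LLR) of code bit $i$. *RALP decoder.* The trellis has nodes $s_i^a$ ($0\le i\le n$, $a\in\{0,1\}$) and edges $(s_{i-1}^a,s_i^b)$. RALP minimizes $\sum_e\gamma_e f_e$, where an edge $e=(s_{i-1}^a,s_i^b)$ has cost $\gamma_e=\gamma_i$ if $b=1$ and $\gamma_e=0$ if $b=0$ (if $\gamma_i=-\infty$, the costs for $b=1$ and $b=0$ are $0$ and $+\infty$), subject to: one unit of flow leaves $s_0^0$;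 flow is conserved at all nodes other than $s_0^0,s_n^0$; for all $t$ and all $i\in X_t$, $x_t$ equals the total flow on $(s_{i-1}^0,s_i^1)$ and $(s_{i-1}^1,s_i^0)$; and $0\le f_e\le 1$. The decoder finds any optimum $(f^*,x^*)$; it outputs $x^*$ if $f^*$ is integral and "error" otherwise. WEP is the probability that the output is not the transmitted information word $u$. *Auxiliary graph.* It has vertices $g_1,\dots,g_n$, the edges $(g_i,g_{i+1})$ for $1\le i<n$, and for each $t$ one hyperedge containing the vertices $g_i$, $i\in X_t$. A path is a sequence of vertices in which any two consecutive ones are distinct and joined by an edge or hyperedge, the same (hyper)edge not being used twice in a row; a cycle is a path of positive length that ends where it begins; the girth is the length of a shortest cycle. Let $\tilde z_1,\tilde z_2,\dots$ be i.i.d. with $\Pr(\tilde z_i\le z)=\Pr(\gamma_i\le z\mid x_i=0)$. **Theorem.** Consider an arbitrary MBIOS channel. (a) (Regular codes.) Let $q\ge 2$ be even, $k\ge 1$, $n=qk$. There are interleavers $\pi_E$ for the RA($q$) code of block length $n$ whose auxiliary graph has girth at least $\lfloor\log_q n\rfloor-1$. If any such $\pi_E$ is used, then for every transmitted word, every choice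 of optima by the RALP decoder, and every integer $0\le m\le\frac12(\log_q n-1)$ (in particular $m=\frac12(\log_q n-1)$ when this is an integer), $$\mathrm{WEP}< n(2q-1)^{m}\cdot\Pr\Big(\sum_{i=1}^{m}\tilde z_i\le 0\Big),$$ provided that the channel is not noiseless, i.e. that $P(\cdot\mid 0)$ and $P(\cdot\mid 1)$ are not mutually singular; for a noiseless channel the inequality holds with $\le$. (b) (Irregular codes.) Suppose that all repetition degrees $q_t$ are even and positive, let $q_{\max}=\max_t q_t$, and suppose that the auxiliary graph has girth at least $g'$. Then for every transmitted word, every choice of optima, and every integer $0\le m\le\frac12 g'$ (in particular $m=\frac12 g'$ when $g'$ is even), $$\mathrm{WEP}< n(2q_{\max}-1)^{m}\cdot\Pr\Big(\sum_{i=1}^{m}\tilde z_i\le 0\Big)$$ if the channel is not noiseless, and the same with $\le$ if it is noiseless. -/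

import Mathlib

open MeasureTheory
open scoped ENNReal NNReal

namespace RACode

/-! ### Memoryless binary-input output-symmetric channels -/

/-- A binary-input output-symmetric channel with output alphabet `Y`.  `dens b` is the conditional
density `P(y | b)` of the output with respect to a reference measure (counting measure for a
discrete alphabet, Lebesgue measure for a continuous one, or any other measure).
Symmetry: an involution `flip` of the alphabet, preserving the reference measure, exchanges the two
conditional laws (for real outputs, usually `flip y = -y`).
Memorylessness is in the use of the channel: see `wordErrorProb`. -/
structure MBIOSChannel (Y : Type*) [MeasurableSpace Y] where
  ref : Measure Y
  dens : ZMod 2 → Y → ℝ≥0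
  measurable_dens : ∀ b, Measurable (dens b)
  lintegral_dens : ∀ b, ∫⁻ y, (dens b y : ℝ≥0∞) ∂ref = 1
  flip : Y → Y
  flip_flip : ∀ y, flip (flip y) = y
  measurePreserving_flip : MeasurePreserving flip ref ref
  dens_flip : ∀ y, dens 1 y = dens 0 (flip y)

namespace MBIOSChannel

variable {Y : Type*} [MeasurableSpace Y]

/-- The conditional law of the output of the channel, given the input bit `b`. -/
noncomputable def law (ch : MBIOSChannel Y) (b : ZMod 2) : Measure Y :=
  ch.ref.withDensity fun y => (ch.dens b y : ℝ≥0∞)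

instance (ch : MBIOSChannel Y) (b : ZMod 2) : IsProbabilityMeasure (ch.law b) :=
  ⟨by rw [law, withDensity_apply _ MeasurableSet.univ, Measure.restrict_univ,
    ch.lintegral_dens b]⟩

/-- The log-likelihood ratio `ln (P(y | 0) / P(y | 1))`.  It is `+∞` where only `P(y | 1)`
vanishes and `-∞` where only `P(y | 0)` vanishes, as for the binary erasure channel. -/
noncomputable def llr (ch : MBIOSChannel Y) (y : Y) : EReal :=
  ENNReal.log ((ch.dens 0 y : ℝ≥0∞) / (ch.dens 1 y : ℝ≥0∞))

/-- The law of the log-likelihood ratio, given that the bit `0` was sent. -/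
noncomputable def llrLaw (ch : MBIOSChannel Y) : Measure EReal :=
  (ch.law 0).map ch.llr

/-- `Pr (z₁ + ⋯ + zₘ ≤ 0)` for i.i.d. `zᵢ` distributed as the log-likelihood ratio given that the
bit `0` was sent. -/
noncomputable def llrSumProb (ch : MBIOSChannel Y) (m : ℕ) : ℝ :=
  (Measure.pi fun _ : Fin m => ch.llrLaw).real {z | ∑ i, z i ≤ 0}

end MBIOSChannel

/-! ### Repeat-accumulate codes -/

/-- An interleaver for a repeat-accumulate code with `k` information bits, in which bit `t` is
repeated `deg t` times, and with block length `n` (necessarily `∑ t, deg t`): a bijection which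
sends copy `j` of bit `t` to a position of the input of the accumulator. -/
abbrev Interleaver {k : ℕ} (deg : Fin k → ℕ) (n : ℕ) : Type :=
  (Σ t : Fin k, Fin (deg t)) ≃ Fin n

variable {k n : ℕ} {deg : Fin k → ℕ}

/-- The information bit which is fed into the accumulator at time `i`. -/
def owner (π : Interleaver deg n) (i : Fin n) : Fin k := (π.symm i).1

/-- The codeword: bit `i` is the mod-2 sum of the inputs of the accumulator up to time `i`. -/
def encode (π : Interleaver deg n) (u : Fin k → ZMod 2) (i : Fin n) : ZMod 2 :=
  ∑ j ∈ Finset.Iic i, u (owner π j)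

/-! ### The trellis of the accumulator and the linear program -/

/-- The edge `(i, a, b)` is the transition, in segment `i`, from state `a` to state `b`. -/
abbrev TrellisEdge (n : ℕ) : Type := Fin n × ZMod 2 × ZMod 2

/-- The node `(i, a)` is state `a` after `i` steps, `0 ≤ i ≤ n`. -/
abbrev TrellisNode (n : ℕ) : Type := Fin (n + 1) × ZMod 2

def TrellisEdge.source (e : TrellisEdge n) : TrellisNode n := (e.1.castSucc, e.2.1)

def TrellisEdge.target (e : TrellisEdge n) : TrellisNode n := (e.1.succ, e.2.2)

/-- Total flow on the edges leaving a node. -/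
noncomputable def outFlow (f : TrellisEdge n → ℝ) (s : TrellisNode n) : ℝ :=
  ∑ e : TrellisEdge n with e.source = s, f e

/-- Total flow on the edges entering a node. -/
noncomputable def inFlow (f : TrellisEdge n → ℝ) (s : TrellisNode n) : ℝ :=
  ∑ e : TrellisEdge n with e.target = s, f e

/-- The two edges of segment `i` which correspond to the input bit `1`. -/
def inputOneEdges (i : Fin n) : Finset (TrellisEdge n) := {(i, 0, 1), (i, 1, 0)}

/-- The feasible points `(f, x)` of the linear program. -/
structure IsFeasible (π : Interleaver deg n) (f : TrellisEdge n → ℝ) (x : Fin k → ℝ) :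
    Prop where
  unit_flow : outFlow f (0, 0) = 1
  conservation : ∀ s : TrellisNode n, s ≠ (0, 0) → s ≠ (Fin.last n, 0) → outFlow f s = inFlow f s
  agreeable : ∀ (t : Fin k) (j : Fin (deg t)), x t = ∑ e ∈ inputOneEdges (π ⟨t, j⟩), f e
  bounds : ∀ e, 0 ≤ f e ∧ f e ≤ 1

/-- The cost of an edge with output label `b` in a segment whose log-likelihood ratio is `γ`: it
is `γ` if the label is `1` and `0` if the label is `0`.  If `γ = -∞` then the costs of the two
labels are `0` and `+∞` instead: since one unit of flow crosses the segment, this is the same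
objective up to an additive constant. -/
noncomputable def edgeCost (γ : EReal) (b : ZMod 2) : EReal :=
  if γ = ⊥ then (if b = 1 then 0 else ⊤) else (if b = 1 then γ else 0)

/-- The objective of the linear program, in `(-∞, +∞]` at nonnegative `f`; the output label of
the edge `(i, a, b)` is `b`. -/
noncomputable def objective (γ : Fin n → EReal) (f : TrellisEdge n → ℝ) : EReal :=
  ∑ e : TrellisEdge n, edgeCost (γ e.1) e.2.2 * (f e : EReal)

/-- The optimum points `(f, x)` of the linear program. -/
def IsOptimal (π : Interleaver deg n) (γ : Fin n → EReal)
    (z : (TrellisEdge n → ℝ) × (Fin k → ℝ)) : Prop :=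
  IsFeasible π z.1 z.2 ∧ ∀ f x, IsFeasible π f x → objective γ z.1 ≤ objective γ f

open Classical in
/-- The output of the decoder which found the optimum point `(f, x)`: the word `x` if `f` is
integral, and `none` ("error") otherwise. -/
noncomputable def ralpOutput (z : (TrellisEdge n → ℝ) × (Fin k → ℝ)) : Option (Fin k → ℝ) :=
  if ∀ e, z.1 e = 0 ∨ z.1 e = 1 then some z.2 else none

/-- A solver for the linear program: a choice of an optimum point for every received word. -/
def IsRALPSolver {Y : Type*} [MeasurableSpace Y] (ch : MBIOSChannel Y) (π : Interleaver deg n)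
    (sol : (Fin n → Y) → (TrellisEdge n → ℝ) × (Fin k → ℝ)) : Prop :=
  ∀ y, IsOptimal π (fun i => ch.llr (y i)) (sol y)

/-- The word error probability of the decoder that uses the solver `sol`, when the information
word `u` is sent over the memoryless channel `ch`. -/
noncomputable def wordErrorProb {Y : Type*} [MeasurableSpace Y] (ch : MBIOSChannel Y)
    (π : Interleaver deg n) (sol : (Fin n → Y) → (TrellisEdge n → ℝ) × (Fin k → ℝ))
    (u : Fin k → ZMod 2) : ℝ :=
  (Measure.pi fun i => ch.law (encode π u i)).real
    {y | ralpOutput (sol y) ≠ some fun t => ((u t).val : ℝ)}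

/-! ### The auxiliary hypergraph and its girth -/

/-- The edges of the auxiliary hypergraph on the vertices `Fin n`: the edges of the Hamiltonian
line, and one matching hyperedge for every information bit. -/
inductive AuxEdge (n k : ℕ) : Type
  | ham (i : Fin (n - 1)) : AuxEdge n k
  | hyper (t : Fin k) : AuxEdge n k

/-- The vertices connected by an edge or hyperedge. -/
def AuxEdge.verts (π : Interleaver deg n) : AuxEdge n k → Set (Fin n)
  | .ham i => {v | v.val = i.val ∨ v.val = i.val + 1}
  | .hyper t => {v | owner π v = t}

/-- A path of length `l` in the auxiliary hypergraph visits the vertices `p 0, …, p l` and travels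
the (hyper)edges `e 0, …, e (l - 1)`; the same (hyper)edge may not be travelled twice in a row. -/
structure IsAuxPath (π : Interleaver deg n) (l : ℕ) (p : ℕ → Fin n) (e : ℕ → AuxEdge n k) :
    Prop where
  step : ∀ j < l, p j ∈ (e j).verts π ∧ p (j + 1) ∈ (e j).verts π ∧ p j ≠ p (j + 1)
  no_turn : ∀ j, j + 1 < l → e j ≠ e (j + 1)

/-- There is a cycle of length `l` in the auxiliary hypergraph. -/
def HasAuxCycle (π : Interleaver deg n) (l : ℕ) : Prop :=
  0 < l ∧ ∃ p e, IsAuxPath π l p e ∧ p l = p 0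

/-- The girth of the auxiliary hypergraph. -/
noncomputable def auxGirth (π : Interleaver deg n) : ℕ∞ :=
  ⨅ (l : ℕ) (_ : HasAuxCycle π l), (l : ℕ∞)

end RACode

namespace RACode

/-! Error bound. Even repetition brings the accumulator back to state 0, so the transmitted path is
feasible for the linear program. A feasible point without flow off this path is the transmitted word
(`ralpOutput_of_offFlow_eq_zero`), so a decoding failure leaves some flow off it. That flow lives on
the Hamiltonian line: the edge from `v` to `v + 1` carries the flow in the wrong state after segment
`v`, whose cost is the signed LLR of code bit `v`. At a vertex the flow goes straight on or turns
onto or off the transmitted path, and agreeability makes the total turning flow equal at all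
vertices of a hyperedge. Turning flow can therefore be handed over to the other vertices of its
hyperedge, which gives a symmetric joint flow (`jointFlow`) with the off-path flow as both marginals
(`sum_jointFlow`): a stationary walk on directed Hamiltonian edges. Optimality makes its mean cost
nonpositive (`exists_cost`), so some trajectory of `m` edges has nonpositive cost
(`exists_chain_sum_nonpos`, `exists_cheap_walk`). The walk takes at most one hyperedge between
Hamiltonian edges, so repeating an edge would close a cycle shorter than `2 * m`
(`walk_bits_injective`). The `m` costs thus belong to distinct bits and, by channel symmetry, are
i.i.d. (`measure_sum_llr_le`). There are at most `2 * n * (2 * q - 1) ^ (m - 1)` walks for `m ≥ 1`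
(`exists_walks`), and the union bound is strict because `2 < 2 * q - 1` and the probability is
positive off the noiseless case (`llrSumProb_pos`). Interleavers. Among the partial assignments of
vertices to bits with classes of size at most `q` and girth at least `g`, one with the most assigned
vertices is total: otherwise counting finds a vertex `w` far from both an unassigned vertex and a
class with room, and reassigning through `w` gains a vertex (`IsGood.exists_more`). -/

/-! ### Trails in partially assigned auxiliary hypergraphs -/

section Trails

variable {n k : ℕ}

/-- A step from `x` to `y` along an edge of the auxiliary hypergraph, where `c` tells the
information bit of a vertex, if it has been assigned one. -/
def IsStep (c : Fin n → Option (Fin k)) : AuxEdge n k → Fin n → Fin n → Prop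
  | .ham i, x, y => (x.val = i.val ∧ y.val = i.val + 1) ∨ (x.val = i.val + 1 ∧ y.val = i.val)
  | .hyper t, x, y => c x = some t ∧ c y = some t ∧ x ≠ y

/-- `Trail c x e y f l`: there is a path of length `l ≥ 1` from `x` to `y` whose first edge is `e`
and whose last edge is `f`. -/
inductive Trail (c : Fin n → Option (Fin k)) :
    Fin n → AuxEdge n k → Fin n → AuxEdge n k → ℕ → Prop
  | single {x e y} : IsStep c e x y → Trail c x e y e 1
  | cons {x e y e' z f l} : IsStep c e x y → e ≠ e' → Trail c y e' z f l → Trail c x e z f (l + 1)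

variable {c c' : Fin n → Option (Fin k)} {x y z : Fin n} {e e' f f' : AuxEdge n k} {l l' g : ℕ}

theorem IsStep.symm (h : IsStep c e x y) : IsStep c e y x := by
  cases e with
  | ham i => simp only [IsStep] at *; omega
  | hyper t => exact ⟨h.2.1, h.1, h.2.2.symm⟩

theorem IsStep.ne (h : IsStep c e x y) : x ≠ y := by
  cases e with
  | ham i => simp only [IsStep] at h; intro hxy; subst hxy; omega
  | hyper t => exact h.2.2

theorem IsStep.trans (h : IsStep c e x y) (h' : IsStep c e y z) (hne : x ≠ z) :
    IsStep c e x z := by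
  cases e with
  | ham i =>
    simp only [IsStep] at *
    exact absurd (Fin.ext (by omega)) hne
  | hyper t => exact ⟨h.1, h'.2.1, hne⟩

theorem IsStep.mono (hc : ∀ v t, c v = some t → c' v = some t) (h : IsStep c e x y) :
    IsStep c' e x y := by
  cases e with
  | ham i => exact h
  | hyper t => exact ⟨hc _ _ h.1, hc _ _ h.2.1, h.2.2⟩

namespace Trail

theorem mono (hc : ∀ v t, c v = some t → c' v = some t) (h : Trail c x e y f l) :
    Trail c' x e y f l := by
  induction h with
  | single h => exact .single (h.mono hc)
  | cons h hne _ ih => exact .cons (h.mono hc) hne ih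

theorem pos (h : Trail c x e y f l) : 0 < l := by
  cases h <;> omega

theorem append (h : Trail c x e y f l) (h' : Trail c y e' z f' l') (hne : f ≠ e') :
    Trail c x e z f' (l + l') := by
  induction h with
  | single h => rw [add_comm]; exact .cons h hne h'
  | cons h hn _ ih => rw [add_right_comm]; exact .cons h hn (ih h' hne)

theorem snoc (h : Trail c x e y f l) (h' : IsStep c f' y z) (hne : f ≠ f') :
    Trail c x e z f' (l + 1) :=
  h.append (.single h') hne

theorem reverse (h : Trail c x e y f l) : Trail c y f x e l := by
  induction h with
  | single h => exact .single h.symm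
  | cons h hn _ ih => exact ih.snoc h.symm hn.symm

theorem first_step (h : Trail c x e y f l) : ∃ z, IsStep c e x z := by
  cases h with
  | single h => exact ⟨_, h⟩
  | cons h _ _ => exact ⟨_, h⟩

theorem last_cases (h : Trail c x e y f l) : (l = 1 ∧ e = f ∧ IsStep c f x y) ∨
    ∃ z f' l', l = l' + 1 ∧ Trail c x e z f' l' ∧ f' ≠ f ∧ IsStep c f z y := by
  have hr := h.reverse
  clear h
  cases hr with
  | single hs => exact .inl ⟨rfl, rfl, hs.symm⟩
  | cons hs hn ht => exact .inr ⟨_, _, _, rfl, ht.reverse, hn.symm, hs.symm⟩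

/-- A shortest closed trail does not turn at its base point either. -/
theorem exists_cyclic (h : Trail c x e x f l) :
    ∃ y e' f' l', l' ≤ l ∧ Trail c y e' y f' l' ∧ e' ≠ f' := by
  induction l using Nat.strong_induction_on generalizing x e f with
  | _ l ih =>
    by_cases hef : e = f
    · subst hef
      cases h with
      | single h => exact absurd rfl h.ne
      | @cons _ _ x₁ e₁ _ _ l h hne h' =>
        rcases h'.last_cases with ⟨-, he, -⟩ | ⟨z, f', l', rfl, ht, hf', hs⟩
        · exact absurd he.symm hne
        -- The first and last steps run on the same edge through the base point: drop both if they
        -- retrace each other, otherwise merge them into one step. Either way a shorter closed trail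
        -- remains.
        · by_cases hz : z = x₁
          · subst hz
            obtain ⟨y, e', f', l'', hl, h1, h2⟩ := ih l' (by omega) ht
            exact ⟨y, e', f', l'', by omega, h1, h2⟩
          · obtain ⟨y, e', f', l'', hl, h1, h2⟩ :=
              ih (l' + 1) (by omega) (ht.snoc (hs.trans h hz) hf')
            exact ⟨y, e', f', l'', by omega, h1, h2⟩
    · exact ⟨x, e, f, l, le_rfl, h, hef⟩

end Trail

/-- All closed trails have length at least `g`. -/
def GirthGE (c : Fin n → Option (Fin k)) (g : ℕ) : Prop :=
  ∀ x e f l, Trail c x e x f l → g ≤ l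

theorem GirthGE.mono (hc : ∀ v t, c v = some t → c' v = some t) (h : GirthGE c' g) :
    GirthGE c g := fun x e f l ht => h x e f l (ht.mono hc)

/-- The Hamiltonian line has no cycles. -/
theorem girthGE_none (g : ℕ) : GirthGE (fun _ : Fin n => (none : Option (Fin k))) g := by
  -- Without hyperedges a trail that never repeats an edge at once keeps its direction, so its
  -- endpoints differ by its length.
  have key : ∀ x e y f l, Trail (fun _ : Fin n => (none : Option (Fin k))) x e y f l →
      ∃ i, e = .ham i ∧ ((x.val = i.val ∧ y.val = x.val + l) ∨
        (x.val = i.val + 1 ∧ y.val + l = x.val)) := by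
    intro x e y f l h
    induction h with
    | @single x e y h =>
      cases e with
      | ham i => simp only [IsStep] at h; exact ⟨i, rfl, by omega⟩
      | hyper t => simp [IsStep] at h
    | @cons x e y e' z f l h hn _ ih =>
      obtain ⟨j, rfl, hj⟩ := ih
      cases e with
      | ham i =>
        simp only [IsStep] at h
        have hij : i.val ≠ j.val := fun hij => hn (by rw [Fin.ext hij])
        exact ⟨i, rfl, by omega⟩
      | hyper t => simp [IsStep] at h
  intro x e f l h
  obtain ⟨i, -, hi⟩ := key _ _ _ _ _ h
  have := h.pos
  omega

/-! ### Assigning one more vertex -/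

theorem step_of_step_update {a : Fin n} {s : Fin k}
    (h : IsStep (Function.update c a (some s)) e x y) (he : e ≠ .hyper s) : IsStep c e x y := by
  cases e with
  | ham i => exact h
  | hyper t =>
    have hts : t ≠ s := fun h => he (by rw [h])
    have aux : ∀ v, Function.update c a (some s) v = some t → c v = some t := by
      intro v hv
      by_cases hva : v = a
      · subst hva; simp at hv; exact absurd hv.symm hts
      · rwa [Function.update_of_ne hva] at hv
    exact ⟨aux _ h.1, aux _ h.2.1, h.2.2⟩

/-- Cutting at the first use of the enlarged hyperedge `s`: everything before the cut is a trail of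
the old assignment. The cases are no use, use as the first edge, and use after a nonempty old
prefix. -/
theorem trail_update_cases {a : Fin n} {s : Fin k}
    (h : Trail (Function.update c a (some s)) x e y f l) :
    Trail c x e y f l ∨ e = .hyper s ∨
    ∃ z z' f' i, Trail c x e z f' i ∧ f' ≠ .hyper s ∧
      IsStep (Function.update c a (some s)) (.hyper s) z z' ∧
      ((z' = y ∧ f = .hyper s ∧ l = i + 1) ∨
        ∃ e₂ j, e₂ ≠ .hyper s ∧ Trail (Function.update c a (some s)) z' e₂ y f j ∧
          l = i + 1 + j) := by
  induction h with
  | @single x e y h =>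
    by_cases he : e = .hyper s
    · exact .inr (.inl he)
    · exact .inl (.single (step_of_step_update h he))
  | @cons x e x₁ e' y f l h hn ht ih =>
    by_cases he : e = .hyper s
    · exact .inr (.inl he)
    have h1 := step_of_step_update h he
    rcases ih with ih | ih | ⟨z, z', f', i, hz, hf', hs, hr⟩
    · exact .inl (.cons h1 hn ih)
    · subst ih
      refine .inr (.inr ?_)
      cases ht with
      | single ht => exact ⟨_, _, e, 1, .single h1, he, ht, .inl ⟨rfl, rfl, rfl⟩⟩
      | @cons _ _ y' e₂ _ _ l ht hn' ht' =>
        exact ⟨_, _, e, 1, .single h1, he, ht, .inr ⟨e₂, l, hn'.symm, ht', by omega⟩⟩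
    · refine .inr (.inr ⟨z, z', f', i + 1, .cons h1 hn hz, hf', hs, ?_⟩)
      rcases hr with ⟨h2, h3, h4⟩ | ⟨e₂, j, h2, h3, h4⟩
      · exact .inl ⟨h2, h3, by omega⟩
      · exact .inr ⟨e₂, j, h2, h3, by omega⟩

/-- A new short cycle must use hyperedge `s`, and hence contains an old trail between two members of
the enlarged class. If both are old members, the old hyperedge already closed it to a cycle; if one
of them is `a`, `hfar` applies. -/
theorem girthGE_update {a : Fin n} {s : Fin k} (ha : c a = none) (hg : GirthGE c g)
    (hfar : ∀ y e f l, c y = some s → Trail c a e y f l → g ≤ l + 1) :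
    GirthGE (Function.update c a (some s)) g := by
  set c' := Function.update c a (some s) with hc'
  have hmono : ∀ v t, c v = some t → c' v = some t := by
    intro v t hv
    rw [hc', Function.update_of_ne]
    · exact hv
    · rintro rfl; rw [ha] at hv; cases hv
  have hold : ∀ v, v ≠ a → c' v = some s → c v = some s := by
    intro v hv h
    rwa [hc', Function.update_of_ne hv] at h
  have core : ∀ u e z f i, Trail c u e z f i → e ≠ .hyper s → c' u = some s → c' z = some s →
      g ≤ i + 1 := by
    intro u e z f i ht he hu hz
    by_cases huz : u = z
    · subst huz; exact (hg _ _ _ _ ht).trans (Nat.le_succ _)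
    by_cases hua : u = a
    · subst hua; exact hfar _ _ _ _ (hold z (Ne.symm huz) hz) ht
    by_cases hza : z = a
    · subst hza; exact hfar _ _ _ _ (hold u huz hu) ht.reverse
    · exact hg _ _ _ _ (Trail.cons (c := c) (e := .hyper s)
        ⟨hold z hza hz, hold u hua hu, Ne.symm huz⟩ he.symm ht)
  have far' : ∀ u e z f i, Trail c' u e z f i → e ≠ .hyper s → c' u = some s → c' z = some s →
      g ≤ i + 1 := by
    intro u e z f i ht he hu hz
    rcases trail_update_cases ht with h | h | ⟨z₁, z', f', i', h1, -, h2, h3⟩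
    · exact core _ _ _ _ _ h he hu hz
    · exact absurd h he
    · have := core _ _ _ _ _ h1 he hu h2.1
      rcases h3 with ⟨-, -, h3⟩ | ⟨_, _, -, -, h3⟩ <;> omega
  intro x e f l h
  obtain ⟨x, e, f, l', hl, h, hef⟩ := h.exists_cyclic
  refine le_trans ?_ hl
  rcases trail_update_cases h with h' | rfl | ⟨z, z', f', i, h1, h2, h3, h4⟩
  · exact hg _ _ _ _ h'
  · cases h with
    | single h => exact absurd rfl h.ne
    | cons h hn ht => exact far' _ _ _ _ _ ht hn.symm h.2.1 h.1
  · rcases h4 with ⟨rfl, rfl, rfl⟩ | ⟨e₂, j, he₂, h5, rfl⟩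
    · exact core _ _ _ _ _ h1 hef h3.2.1 h3.1
    -- Rotate the cycle to start just after its use of hyperedge `s`; `hef` keeps it a trail at the
    -- old base point.
    · have := far' _ _ _ _ _ (h5.append (h1.mono hmono) hef.symm) he₂ h3.2.1 h3.1
      omega

/-! ### Counting the vertices at a given distance -/

/-- `z` can be reached from `x` in `l` steps, the first of them on the Hamiltonian line. -/
def LineReach (c : Fin n → Option (Fin k)) (x : Fin n) (l : ℕ) (z : Fin n) : Prop :=
  (l = 0 ∧ z = x) ∨ ∃ i f, Trail c x (.ham i) z f l

open Classical in
theorem card_ham_steps (v : Fin n) :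
    (Finset.univ.filter fun p : Fin n × Fin (n - 1) => IsStep c (.ham p.2) v p.1).card ≤ 2 := by
  refine le_trans (Finset.card_le_card_of_injOn (t := {v.val + 1, v.val - 1}) (fun p => p.1.val)
    ?_ ?_) (Finset.card_le_two (a := v.val + 1) (b := v.val - 1))
  · intro p hp
    have hp := (Finset.mem_filter.1 (Finset.mem_coe.1 hp)).2
    simp only [IsStep] at hp
    simp only [Finset.coe_insert, Finset.coe_singleton, Set.mem_insert_iff,
      Set.mem_singleton_iff]
    omega
  · intro p hp p' hp' h
    have hp := (Finset.mem_filter.1 (Finset.mem_coe.1 hp)).2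
    have hp' := (Finset.mem_filter.1 (Finset.mem_coe.1 hp')).2
    simp only [IsStep] at hp hp' h
    exact Prod.ext (Fin.ext h) (Fin.ext (by omega))

open Classical in
theorem card_ham_steps_ne {i : Fin (n - 1)} {u v : Fin n} (h : IsStep c (.ham i) u v) :
    (Finset.univ.filter fun p : Fin n × Fin (n - 1) =>
      IsStep c (.ham p.2) v p.1 ∧ p.2 ≠ i).card ≤ 1 := by
  rw [Finset.card_le_one]
  intro p hp p' hp'
  simp only [Finset.mem_filter, Finset.mem_univ, true_and, IsStep, ne_eq, Fin.ext_iff] at hp hp' h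
  exact Prod.ext (Fin.ext (by omega)) (Fin.ext (by omega))

/-- The number of endpoints of trails, counted with their last edges, grows at most by the
factor `q` in every step. -/
theorem exists_trail_ends {q : ℕ} (hq : 2 ≤ q)
    (hc : ∀ t, (Finset.univ.filter fun v => c v = some t).card ≤ q) (x : Fin n) (l : ℕ) :
    ∃ S : Finset (Fin n × AuxEdge n k), S.card ≤ q ^ (l + 1) ∧
      ∀ i z f, Trail c x (.ham i) z f (l + 1) → (z, f) ∈ S := by
  classical
  induction l with
  | zero =>
    refine ⟨(Finset.univ.filter fun p : Fin n × Fin (n - 1) => IsStep c (.ham p.2) x p.1).image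
      fun p => (p.1, .ham p.2), ?_, ?_⟩
    · exact Finset.card_image_le.trans ((card_ham_steps x).trans (by simpa using hq))
    · intro i z f h
      rcases h.last_cases with ⟨-, rfl, h⟩ | ⟨_, _, l', hl, h, -⟩
      · exact Finset.mem_image.2 ⟨(z, i), by simpa using h, rfl⟩
      · have := h.pos; omega
  | succ l ih =>
    obtain ⟨S, hS, hmem⟩ := ih
    -- `S` may contain spurious pairs; the continuation count needs the recorded edge to end at the
    -- recorded vertex.
    set S' := S.filter fun p => ∃ u, IsStep c p.2 u p.1 with hS'
    let N : Fin n × AuxEdge n k → Finset (Fin n × AuxEdge n k) := fun p =>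
      ((Finset.univ.filter fun r : Fin n × Fin (n - 1) =>
        IsStep c (.ham r.2) p.1 r.1 ∧ AuxEdge.ham r.2 ≠ p.2).image fun r => (r.1, .ham r.2)) ∪
      ((Finset.univ.filter fun r : Fin n × Fin k =>
        IsStep c (.hyper r.2) p.1 r.1 ∧ AuxEdge.hyper r.2 ≠ p.2).image fun r => (r.1, .hyper r.2))
    have hN : ∀ p ∈ S', (N p).card ≤ q := by
      rintro ⟨v, e⟩ hp
      obtain ⟨-, u, hu⟩ := Finset.mem_filter.1 hp
      refine (Finset.card_union_le _ _).trans
        ((add_le_add Finset.card_image_le Finset.card_image_le).trans ?_)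
      -- After a Hamiltonian edge come at most one more Hamiltonian step and `q - 1` hyperedge
      -- steps; after a hyperedge, at most two Hamiltonian steps, and `2 ≤ q`.
      cases e with
      | ham i =>
        have h1 := card_ham_steps_ne (c := c) hu
        have h2 : (Finset.univ.filter fun r : Fin n × Fin k =>
            IsStep c (.hyper r.2) v r.1 ∧ (AuxEdge.hyper r.2 : AuxEdge n k) ≠ .ham i).card
            ≤ q - 1 := by
          rcases hcv : c v with _ | t
          · simp [IsStep, hcv]
          · refine le_trans (Finset.card_le_card_of_injOn
              (t := (Finset.univ.filter fun w => c w = some t).erase v) (fun r => r.1) ?_ ?_) ?_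
            · intro r hr
              simp only [Finset.mem_coe, Finset.mem_filter, Finset.mem_univ, true_and, IsStep,
                hcv, Option.some.injEq] at hr
              simp only [Finset.mem_coe, Finset.mem_erase, Finset.mem_filter,
                Finset.mem_univ, true_and]
              obtain ⟨⟨h1, h2, h3⟩, -⟩ := hr
              exact ⟨Ne.symm h3, by rw [h2, h1]⟩
            · intro r hr r' hr' h
              simp only [Finset.mem_coe, Finset.mem_filter, Finset.mem_univ, true_and, IsStep,
                hcv, Option.some.injEq] at hr hr'
              exact Prod.ext h (hr.1.1.symm.trans hr'.1.1)
            · rw [Finset.card_erase_of_mem (by simpa using hcv)]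
              exact Nat.sub_le_sub_right (hc t) 1
        have h1' : (Finset.univ.filter fun r : Fin n × Fin (n - 1) =>
            IsStep c (.ham r.2) v r.1 ∧ (AuxEdge.ham r.2 : AuxEdge n k) ≠ .ham i).card ≤ 1 := by
          simpa using h1
        exact (add_le_add h1' h2).trans (by omega)
      | hyper t =>
        have h1 := card_ham_steps (c := c) v
        have h2 : (Finset.univ.filter fun r : Fin n × Fin k =>
            IsStep c (.hyper r.2) v r.1 ∧ (AuxEdge.hyper r.2 : AuxEdge n k) ≠ .hyper t).card
            = 0 := by
          rw [Finset.card_eq_zero, Finset.filter_eq_empty_iff]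
          rintro ⟨w, t'⟩ - ⟨h, hne⟩
          have := h.1.symm.trans hu.2.1
          simp only [Option.some.injEq] at this
          exact hne (by simp [this])
        have h1' : (Finset.univ.filter fun r : Fin n × Fin (n - 1) =>
            IsStep c (.ham r.2) v r.1 ∧ (AuxEdge.ham r.2 : AuxEdge n k) ≠ .hyper t).card ≤ 2 := by
          simpa using h1
        exact (add_le_add h1' h2.le).trans (by omega)
    refine ⟨S'.biUnion N, ?_, ?_⟩
    · calc (S'.biUnion N).card ≤ S'.card * q := Finset.card_biUnion_le_card_mul _ _ _ hN
        _ ≤ q ^ (l + 1) * q := Nat.mul_le_mul_right _ ((Finset.card_filter_le _ _).trans hS)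
        _ = q ^ (l + 1 + 1) := (pow_succ _ _).symm
    · intro i z f h
      rcases h.last_cases with ⟨hl, -⟩ | ⟨y, f', l', hl, h, hne, hs⟩
      · omega
      · obtain rfl : l' = l + 1 := by omega
        refine Finset.mem_biUnion.2 ⟨(y, f'), ?_, ?_⟩
        · refine Finset.mem_filter.2 ⟨hmem _ _ _ h, ?_⟩
          rcases h.last_cases with ⟨-, -, h⟩ | ⟨_, _, _, _, _, _, h⟩ <;> exact ⟨_, h⟩
        · cases f with
          | ham j =>
            exact Finset.mem_union_left _ (Finset.mem_image.2 ⟨(z, j), Finset.mem_filter.2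
              ⟨Finset.mem_univ _, hs, hne.symm⟩, rfl⟩)
          | hyper t =>
            exact Finset.mem_union_right _ (Finset.mem_image.2 ⟨(z, t), Finset.mem_filter.2
              ⟨Finset.mem_univ _, hs, hne.symm⟩, rfl⟩)

open Classical in
theorem card_lineReach {q : ℕ} (hq : 2 ≤ q)
    (hc : ∀ t, (Finset.univ.filter fun v => c v = some t).card ≤ q) (x : Fin n) (l : ℕ) :
    (Finset.univ.filter (LineReach c x l)).card ≤ q ^ l := by
  rcases l with _ | l
  · rw [pow_zero, Finset.card_le_one]
    intro a ha b hb
    simp only [LineReach, Finset.mem_filter, Finset.mem_univ, true_and] at ha hb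
    have aux : ∀ w, (w = x ∨ ∃ i f, Trail c x (.ham i) w f 0) → w = x := by
      rintro w (h | ⟨i, f, h⟩)
      · exact h
      · exact absurd h.pos (lt_irrefl 0)
    rw [aux a ha, aux b hb]
  · obtain ⟨S, hS, hmem⟩ := exists_trail_ends hq hc x l
    refine le_trans (Finset.card_le_card ?_) ((Finset.card_image_le (f := Prod.fst)).trans hS)
    intro z hz
    simp only [LineReach, Finset.mem_filter, Finset.mem_univ, true_and] at hz
    rcases hz with ⟨h, -⟩ | ⟨i, f, h⟩
    · omega
    · exact Finset.mem_image.2 ⟨(z, f), hmem _ _ _ h, rfl⟩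

-- Summation of the geometric series; the factor `q - 1` is kept on the left because it will cancel
-- against the at most `q - 1` members of a class with room.
open Classical in
theorem card_lineReach_ball {q : ℕ} (hq : 2 ≤ q)
    (hc : ∀ t, (Finset.univ.filter fun v => c v = some t).card ≤ q) (x : Fin n) (r : ℕ) :
    (q - 1) * ((Finset.range r).biUnion fun l => Finset.univ.filter (LineReach c x l)).card
      < q ^ r := by
  have h1 : ((Finset.range r).biUnion fun l => Finset.univ.filter (LineReach c x l)).card
      ≤ ∑ l ∈ Finset.range r, q ^ l :=
    Finset.card_biUnion_le.trans (Finset.sum_le_sum fun l _ => card_lineReach hq hc x l)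
  have h2 : (∑ l ∈ Finset.range r, q ^ l) * (q - 1) = q ^ r - 1 := by
    obtain ⟨p, rfl⟩ : ∃ p, q = p + 1 := ⟨q - 1, by omega⟩
    have := geom_sum_mul_add p r
    simp only [Nat.add_sub_cancel]
    omega
  have h3 : 0 < q ^ r := by positivity
  calc _ ≤ (q - 1) * ∑ l ∈ Finset.range r, q ^ l := Nat.mul_le_mul_left _ h1
    _ = q ^ r - 1 := by rw [mul_comm, h2]
    _ < q ^ r := by omega

theorem Trail.lineReach (h : Trail c x e y f l) (he : ∀ t, e ≠ .hyper t) : LineReach c x l y := by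
  cases e with
  | ham i => exact .inr ⟨i, f, h⟩
  | hyper t => exact absurd rfl (he t)

theorem Trail.first_ne_hyper (h : Trail c x e y f l) (hx : c x = none) (t : Fin k) :
    e ≠ .hyper t := by
  rintro rfl
  obtain ⟨z, hz⟩ := h.first_step
  rw [hz.1] at hx
  cases hx

end Trails
-- Interleavers of logarithmic girth by an extremal argument
section Existence

variable {n k : ℕ}

/-- A partial assignment with classes of size at most `q` and girth at least `g`. -/
structure IsGood (q g : ℕ) (c : Fin n → Option (Fin k)) : Prop where
  card_le : ∀ t, Nat.card {v // c v = some t} ≤ q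
  girth : GirthGE c g

theorem natCard_class (c : Fin n → Option (Fin k)) (t : Fin k)
    [DecidablePred fun v => c v = some t] :
    Nat.card {v // c v = some t} = (Finset.univ.filter fun v => c v = some t).card := by
  rw [Nat.card_eq_fintype_card, Fintype.card_subtype]

/-- Number of assigned vertices. -/
noncomputable def assigned (c : Fin n → Option (Fin k)) : ℕ := Nat.card {v // c v ≠ none}

theorem assigned_eq_sum (c : Fin n → Option (Fin k)) :
    assigned c = ∑ t, Nat.card {v // c v = some t} := by
  classical
  rw [assigned, Nat.card_eq_fintype_card, Fintype.card_subtype,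
    Finset.card_eq_sum_card_fiberwise (f := c) (t := Finset.univ) (by simp [Set.MapsTo])]
  rw [Fintype.sum_option]
  simp only [natCard_class]
  rw [Finset.card_eq_zero.2, zero_add]
  · refine Finset.sum_congr rfl fun t _ => congrArg _ ?_
    ext v
    simp only [Finset.mem_filter, Finset.mem_univ, true_and, and_iff_right_iff_imp]
    intro h; simp [h]
  · ext v; simp

theorem class_update_of_ne (c : Fin n → Option (Fin k)) (a : Fin n) (ha : c a = none)
    (s t : Fin k) (hst : t ≠ s) :
    Nat.card {v // Function.update c a (some s) v = some t} = Nat.card {v // c v = some t} := by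
  refine Nat.card_congr (Equiv.subtypeEquivRight fun v => ?_)
  by_cases hv : v = a
  · subst hv; simp [ha, hst.symm]
  · simp [Function.update_of_ne hv]

theorem class_update_self (c : Fin n → Option (Fin k)) (a : Fin n) (ha : c a = none)
    (s : Fin k) :
    Nat.card {v // Function.update c a (some s) v = some s} = Nat.card {v // c v = some s} + 1 := by
  classical
  rw [natCard_class, natCard_class,
    ← Finset.card_insert_of_notMem (a := a) (by simp [ha])]
  congr 1
  ext v
  by_cases hv : v = a
  · subst hv; simp
  · simp [hv]

theorem assigned_update (c : Fin n → Option (Fin k)) (a : Fin n) (ha : c a = none) (s : Fin k) :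
    assigned (Function.update c a (some s)) = assigned c + 1 := by
  rw [assigned_eq_sum, assigned_eq_sum, ← Finset.add_sum_erase _ _ (Finset.mem_univ s),
    ← Finset.add_sum_erase (a := s) _ (fun t => Nat.card {v // c v = some t}) (Finset.mem_univ s),
    class_update_self c a ha, add_right_comm]
  congr 1
  congr 1
  exact Finset.sum_congr rfl fun t ht => class_update_of_ne c a ha s t (Finset.ne_of_mem_erase ht)

variable {c : Fin n → Option (Fin k)} {q g : ℕ}

theorem IsGood.update (h : IsGood q g c) {a : Fin n} {s : Fin k} (ha : c a = none)
    (hs : Nat.card {v // c v = some s} < q)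
    (hfar : ∀ y e f l, c y = some s → Trail c a e y f l → g ≤ l + 1) :
    IsGood q g (Function.update c a (some s)) := by
  refine ⟨fun t => ?_, girthGE_update ha h.girth hfar⟩
  by_cases hts : t = s
  · subst hts; rw [class_update_self c a ha]; exact hs
  · rw [class_update_of_ne c a ha s t hts]; exact h.card_le t

/-- If not every vertex is assigned, then the assignment can be changed such that one more vertex
is assigned. -/
theorem IsGood.exists_more (hq : 2 ≤ q) (h : IsGood q g c) (hn : n = q * k)
    (hg : q ^ (g + 1) ≤ n) (hg1 : 2 ≤ g) {v : Fin n} (hv : c v = none) :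
    ∃ c' : Fin n → Option (Fin k), IsGood q g c' ∧ assigned c < assigned c' := by
  classical
  have hcard : ∀ t, (Finset.univ.filter fun v => c v = some t).card ≤ q := fun t => by
    rw [← natCard_class]; exact h.card_le t
  obtain ⟨t, ht⟩ : ∃ t, Nat.card {v // c v = some t} < q := by
    by_contra! hcon
    have h1 : assigned c < n := by
      rw [assigned, Nat.card_eq_fintype_card]
      exact (Fintype.card_subtype_lt (x := v) (by simpa using hv)).trans_eq (Fintype.card_fin n)
    have h2 : q * k ≤ assigned c := by
      rw [assigned_eq_sum]
      calc q * k = ∑ _t : Fin k, q := by simp [mul_comm]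
        _ ≤ _ := Finset.sum_le_sum fun t _ => hcon t
    omega
  let T : Finset (Fin n) := Finset.univ.filter fun x => c x = some t
  have hT : T.card ≤ q - 1 := by
    have : T.card = Nat.card {v // c v = some t} := (natCard_class c t).symm
    omega
  let B : Fin n → ℕ → Finset (Fin n) := fun x r =>
    (Finset.range r).biUnion fun l => Finset.univ.filter (LineReach c x l)
  have hB : ∀ x r, (q - 1) * (B x r).card < q ^ r := fun x r => card_lineReach_ball hq hcard x r
  have hmemB : ∀ x r l z, l < r → LineReach c x l z → z ∈ B x r := fun x r l z hl hz =>
    Finset.mem_biUnion.2 ⟨l, Finset.mem_range.2 hl, by simpa using hz⟩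
  -- The balls around the at most `q - 1` members of `T` cover at most `q ^ (g - 1)` vertices and
  -- the ball around `v` fewer than `q ^ g`; together this is less than `q ^ (g + 1) ≤ n`.
  obtain ⟨w, hw⟩ : ∃ w, w ∉ T.biUnion (fun x => B x (g - 1)) ∪ B v g := by
    by_contra! hcon
    have h1 : n ≤ (T.biUnion (fun x => B x (g - 1)) ∪ B v g).card := by
      rw [Finset.eq_univ_iff_forall.2 hcon]; simp
    have h2 : (T.biUnion (fun x => B x (g - 1))).card ≤ q ^ (g - 1) := by
      refine Finset.card_biUnion_le.trans ?_
      have hq1 : 0 < q - 1 := by omega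
      refine Nat.le_of_mul_le_mul_left ?_ hq1
      rw [Finset.mul_sum]
      calc ∑ x ∈ T, (q - 1) * (B x (g - 1)).card ≤ ∑ x ∈ T, q ^ (g - 1) :=
            Finset.sum_le_sum fun x _ => (hB x _).le
        _ = T.card * q ^ (g - 1) := by simp
        _ ≤ _ := Nat.mul_le_mul_right _ hT
    have h3 : (B v g).card < q ^ g := by
      refine lt_of_le_of_lt ?_ (hB v g)
      exact Nat.le_mul_of_pos_left _ (by omega)
    have h4 := Finset.card_union_le (T.biUnion (fun x => B x (g - 1))) (B v g)
    obtain ⟨g, rfl⟩ : ∃ j, g = j + 1 := ⟨g - 1, by omega⟩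
    simp only [Nat.add_sub_cancel] at *
    have h5 : q ^ g + q ^ (g + 1) ≤ q ^ (g + 1 + 1) := by
      rw [pow_succ q (g + 1), pow_succ q g]
      have : 1 + q ≤ q * q := by nlinarith
      calc q ^ g + q ^ g * q = q ^ g * (1 + q) := by ring
        _ ≤ q ^ g * (q * q) := Nat.mul_le_mul_left _ this
        _ = _ := by ring
    omega
  simp only [Finset.mem_union, Finset.mem_biUnion, not_or, not_exists, not_and] at hw
  obtain ⟨hwT, hwv⟩ := hw
  have htw : ∀ x l, c x = some t → l + 1 < g → ¬ LineReach c x l w := fun x l hx hl hr =>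
    hwT x (by simpa [T] using hx) (hmemB _ _ l _ (by omega) hr)
  have hvw : ∀ l, l < g → ¬ LineReach c v l w := fun l hl hr => hwv (hmemB _ _ l _ hl hr)
  have hwv' : w ≠ v := fun hwv' => hvw 0 (by omega) (.inl ⟨rfl, hwv'⟩)
  -- The balls only see trails leaving along the line. A trail that leaves `T` by hyperedge `t` is
  -- shortened by starting at the next vertex, which also lies in `T`.
  have hfarT : ∀ y e f l, c y = some t → Trail c w e y f l → g ≤ l + 1 := by
    intro y e f l hy htr
    by_contra! hl
    have hr := htr.reverse
    by_cases hft : f = .hyper t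
    · subst hft
      cases hr with
      | single hs => exact htw w 0 hs.2.1 (by omega) (.inl ⟨rfl, rfl⟩)
      | @cons _ _ x _ _ _ l hs hne hr =>
        refine htw x l hs.2.1 (by omega) (hr.lineReach fun t' ht' => hne ?_)
        subst ht'
        obtain ⟨_, h'⟩ := hr.first_step
        have := h'.1.symm.trans hs.2.1
        simp only [Option.some.injEq] at this
        rw [this]
    · refine htw y l hy hl (hr.lineReach fun t' ht' => hft ?_)
      subst ht'
      obtain ⟨_, h'⟩ := hr.first_step
      have := h'.1.symm.trans hy
      simp only [Option.some.injEq] at this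
      rw [this]
  rcases hcw : c w with _ | s
  · exact ⟨_, h.update hcw ht hfarT, by rw [assigned_update c w hcw]; omega⟩
  -- Swap: `v` takes the place of `w` in class `s`, and `w` moves to class `t`.
  set c₁ := Function.update c w none with hc₁
  have hmono : ∀ x t, c₁ x = some t → c x = some t := by
    intro x t hx
    by_cases hxw : x = w
    · subst hxw; simp [hc₁] at hx
    · rwa [hc₁, Function.update_of_ne hxw] at hx
  have hback : Function.update c₁ w (some s) = c := by
    rw [hc₁, Function.update_idem, ← hcw, Function.update_eq_self]
  have hw₁ : c₁ w = none := by simp [hc₁]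
  have hv₁ : c₁ v = none := by rw [hc₁, Function.update_of_ne hwv'.symm, hv]
  have hcs : Nat.card {x // c x = some s} = Nat.card {x // c₁ x = some s} + 1 := by
    rw [← class_update_self c₁ w hw₁ s, hback]
  have hcne : ∀ r, r ≠ s → Nat.card {x // c x = some r} = Nat.card {x // c₁ x = some r} := by
    intro r hr
    rw [← class_update_of_ne c₁ w hw₁ s r hr, hback]
  have hass : assigned c = assigned c₁ + 1 := by
    rw [← assigned_update c₁ w hw₁ s, hback]
  have hgood₁ : IsGood q g c₁ := by
    refine ⟨fun r => ?_, h.girth.mono hmono⟩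
    have := h.card_le r
    by_cases hr : r = s
    · subst hr; omega
    · rw [← hcne r hr]; exact this
  have hts : t ≠ s := by
    rintro rfl
    exact htw w 0 hcw (by omega) (.inl ⟨rfl, rfl⟩)
  have hgood₂ : IsGood q g (Function.update c₁ v (some s)) := by
    refine hgood₁.update hv₁ (by have := h.card_le s; omega) ?_
    -- A short trail from `v` to class `s` would extend, or be redirected in its last step, to `w`
    -- along the old hyperedge, yet `w` is far from `v`.
    intro y e f l hy htr
    by_contra! hl
    have hyw : y ≠ w := by rintro rfl; rw [hw₁] at hy; cases hy
    have htr' := htr.mono hmono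
    have hcy := hmono _ _ hy
    by_cases hfs : f = .hyper s
    · subst hfs
      rcases htr'.last_cases with ⟨-, rfl, hst⟩ | ⟨z, f', l', rfl, hz, hne, hst⟩
      · have := hst.1
        rw [hv] at this; cases this
      · by_cases hzw : z = w
        · subst hzw
          exact hvw l' (by omega) (hz.lineReach (hz.first_ne_hyper hv))
        · have := hz.snoc (f' := .hyper s) (z := w) ⟨hst.1, hcw, hzw⟩ hne
          exact hvw _ (by omega) (this.lineReach (this.first_ne_hyper hv))
    · have := htr'.snoc (f' := .hyper s) (z := w) ⟨hcy, hcw, hyw⟩ hfs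
      exact hvw _ hl (this.lineReach (this.first_ne_hyper hv))
  have hw₂ : Function.update c₁ v (some s) w = none := by
    rw [Function.update_of_ne hwv', hw₁]
  refine ⟨_, hgood₂.update (a := w) (s := t) hw₂ ?_ ?_, ?_⟩
  · rw [class_update_of_ne c₁ v hv₁ s t hts, ← hcne t hts]; exact ht
  · intro y e f l hy htr
    have hyv : y ≠ v := by
      rintro rfl
      simp only [Function.update_self, Option.some.injEq] at hy
      exact hts hy.symm
    rw [Function.update_of_ne hyv] at hy
    -- A trail through the new hyperedge `s` first meets it at `v`, which is far from `w`, or at an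
    -- old member, from which the old hyperedge back to `w` would close a short cycle of `c`.
    rcases trail_update_cases htr with h1 | rfl | ⟨z, z', f', i, h1, hf', hs, hr⟩
    · exact hfarT _ _ _ _ (hmono _ _ hy) (h1.mono hmono)
    · obtain ⟨_, h'⟩ := htr.first_step
      have := h'.1
      rw [hw₂] at this; cases this
    · have hil : i + 1 ≤ l := by
        rcases hr with ⟨-, -, hr⟩ | ⟨_, _, -, -, hr⟩ <;> omega
      have h2 := h1.mono hmono
      by_contra! hl
      by_cases hzv : z = v
      · subst hzv
        exact hvw i (by omega) (h2.reverse.lineReach (h2.reverse.first_ne_hyper hv))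
      · have hz : c₁ z = some s := by
          have := hs.1
          rwa [Function.update_of_ne hzv] at this
        by_cases hzw : z = w
        · subst hzw; rw [hw₁] at hz; cases hz
        · have := h.girth _ _ _ _ (h2.snoc (f' := .hyper s) (z := w) ⟨hmono _ _ hz, hcw, hzw⟩ hf')
          omega
  · rw [assigned_update _ w hw₂, assigned_update _ v hv₁]
    omega

theorem exists_full_assignment (q k n g : ℕ) (hq : 2 ≤ q) (hn : n = q * k)
    (hg : q ^ (g + 1) ≤ n) (hg1 : 2 ≤ g) :
    ∃ c : Fin n → Option (Fin k), IsGood q g c ∧ ∀ v, c v ≠ none := by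
  classical
  have hne : (Finset.univ.filter fun c : Fin n → Option (Fin k) => IsGood q g c).Nonempty := by
    refine ⟨fun _ => none, ?_⟩
    simp only [Finset.mem_filter, Finset.mem_univ, true_and]
    exact ⟨fun t => by simp, girthGE_none g⟩
  obtain ⟨c, hc, hmax⟩ := Finset.exists_max_image _ assigned hne
  simp only [Finset.mem_filter, Finset.mem_univ, true_and] at hc hmax
  refine ⟨c, hc, fun v hv => ?_⟩
  obtain ⟨c', h1, h2⟩ := hc.exists_more hq hn hg hg1 hv
  exact absurd (hmax c' h1) (not_le.2 h2)

theorem IsAuxPath.trail {deg : Fin k → ℕ} {π : Interleaver deg n} {l : ℕ} {p : ℕ → Fin n}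
    {e : ℕ → AuxEdge n k} (h : IsAuxPath π (l + 1) p e) :
    Trail (fun v => some (owner π v)) (p 0) (e 0) (p (l + 1)) (e l) (l + 1) := by
  have hstep : ∀ j < l + 1, IsStep (fun v => some (owner π v)) (e j) (p j) (p (j + 1)) := by
    intro j hj
    obtain ⟨h1, h2, h3⟩ := h.step j hj
    cases he : e j with
    | ham i =>
      simp only [he, AuxEdge.verts, Set.mem_ofPred_eq] at h1 h2
      have : (p j).val ≠ (p (j + 1)).val := fun h => h3 (Fin.ext h)
      simp only [IsStep]; omega
    | hyper t =>
      simp only [he, AuxEdge.verts, Set.mem_ofPred_eq] at h1 h2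
      exact ⟨by simp [h1], by simp [h2], h3⟩
  induction l with
  | zero => exact .single (hstep 0 (by omega))
  | succ l ih =>
    refine (ih ⟨fun j hj => h.step j (by omega), fun j hj => h.no_turn j (by omega)⟩
      fun j hj => hstep j (by omega)).snoc (hstep (l + 1) (by omega)) (h.no_turn l (by omega))

theorem le_auxGirth_of_girthGE {deg : Fin k → ℕ} {π : Interleaver deg n} {g : ℕ}
    (h : GirthGE (fun v => some (owner π v)) g) : (g : ℕ∞) ≤ auxGirth π := by
  refine le_iInf fun l => le_iInf fun hl => ?_
  obtain ⟨hpos, p, e, hp, hcl⟩ := hl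
  obtain ⟨l, rfl⟩ : ∃ j, l = j + 1 := ⟨l - 1, by omega⟩
  have := hp.trail
  rw [hcl] at this
  exact_mod_cast h _ _ _ _ this

theorem exists_interleaver (q k n : ℕ) (hq : 2 ≤ q) (hk : 0 < k) (hn : n = q * k) :
    ∃ π : Interleaver (fun _ : Fin k => q) n,
      ((Nat.log q n - 1 : ℕ) : ℕ∞) ≤ auxGirth π := by
  classical
  by_cases hL : Nat.log q n - 1 ≤ 1
  -- Cycles have positive length, so any interleaver serves when the required girth is at most 1.
  · refine ⟨(finSigmaFinEquiv.trans (finCongr (by simp [hn, mul_comm]))), ?_⟩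
    exact le_iInf fun l => le_iInf fun hl => by exact_mod_cast hL.trans hl.1
  set g := Nat.log q n - 1 with hg
  have hn0 : n ≠ 0 := by rw [hn]; positivity
  obtain ⟨c, hc, hfull⟩ := exists_full_assignment q k n g hq hn
    ((Nat.pow_le_pow_right (by omega) (by omega)).trans (Nat.pow_log_le_self q hn0)) (by omega)
  choose o ho using fun v => Option.ne_none_iff_exists'.1 (hfull v)
  have hle : ∀ t, Nat.card {v // o v = t} ≤ q := by
    intro t
    refine le_trans (le_of_eq (Nat.card_congr (Equiv.subtypeEquivRight fun v => ?_))) (hc.card_le t)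
    rw [ho]; simp
  have hsum : ∑ t, Nat.card {v // o v = t} = ∑ _t : Fin k, q := by
    have : Nat.card (Σ t, {v // o v = t}) = Nat.card (Fin n) :=
      Nat.card_congr (Equiv.sigmaFiberEquiv o)
    rw [Nat.card_sigma] at this
    rw [this]; simp [hn, mul_comm]
  have heq : ∀ t, Nat.card {v // o v = t} = q := fun t =>
    (Finset.sum_eq_sum_iff_of_le fun t _ => hle t).1 hsum t (Finset.mem_univ t)
  let π : Interleaver (fun _ : Fin k => q) n :=
    (Equiv.sigmaCongrRight fun t => (Finite.equivFinOfCardEq (heq t)).symm).trans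
      (Equiv.sigmaFiberEquiv o)
  refine ⟨π, le_auxGirth_of_girthGE ?_⟩
  have : (fun v => some (owner π v)) = c := by
    funext v
    rw [ho]
    rfl
  rw [this]
  exact hc.girth

end Existence
/-! ### Stationary walks -/

/-- In a stationary walk with nonpositive mean cost, some trajectory has nonpositive cost. -/
theorem exists_chain_sum_nonpos {D : Type*} [Fintype D] (μ w : D → ℝ) (Q : D → D → ℝ)
    (hQ : ∀ d d', 0 ≤ Q d d') (hrow : ∀ d, ∑ d', Q d d' = μ d) (hcol : ∀ d', ∑ d, Q d d' = μ d')
    (hw : ∑ d, μ d * w d ≤ 0) (hpos : ∃ d, 0 < μ d) (m : ℕ) :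
    ∃ d : ℕ → D, (∀ j < m, 0 < Q (d j) (d (j + 1))) ∧ ∑ j ∈ Finset.range m, w (d j) ≤ 0 := by
  classical
  have hμ : ∀ d, 0 ≤ μ d := fun d => by
    rw [← hrow]; exact Finset.sum_nonneg fun _ _ => hQ _ _
  -- The terminal cost `G` lets the induction peel off the last step.
  have key : ∀ G : D → ℝ, ∑ d, μ d * (m * w d + G d) ≤ 0 →
      ∃ d : ℕ → D, (∀ j < m, 0 < Q (d j) (d (j + 1))) ∧ 0 < μ (d m) ∧
        ∑ j ∈ Finset.range m, w (d j) + G (d m) ≤ 0 := by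
    induction m with
    | zero =>
      intro G hG
      by_contra! hcon
      obtain ⟨d₀, hd₀⟩ := hpos
      have h1 : ∀ d, 0 < μ d → 0 < G d := fun d hd => by
        simpa using hcon (fun _ => d) (by simp) hd
      have : 0 < ∑ d, μ d * ((0 : ℕ) * w d + G d) := by
        refine Finset.sum_pos' (fun d _ => ?_) ⟨d₀, Finset.mem_univ _, ?_⟩
        · rcases (hμ d).eq_or_lt with h | h
          · simp [← h]
          · have := h1 d h; simp only [Nat.cast_zero, zero_mul, zero_add]; positivity
        · have := h1 d₀ hd₀; simp only [Nat.cast_zero, zero_mul, zero_add]; positivity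
      linarith
    | succ m ih =>
      intro G hG
      -- Move greedily to a successor of least terminal cost. Since both marginals of `Q` are `μ`,
      -- this does not raise the mean of `G`.
      have hnxt : ∀ d, ∃ d', 0 < μ d → (0 < Q d d' ∧ ∀ e, 0 < Q d e → G d' ≤ G e) := by
        intro d
        by_cases hd : 0 < μ d
        · have hne : (Finset.univ.filter fun e => 0 < Q d e).Nonempty := by
            by_contra! hem
            rw [Finset.filter_eq_empty_iff] at hem
            have : ∑ e, Q d e ≤ 0 := Finset.sum_nonpos fun e he => not_lt.1 (hem he)
            rw [hrow] at this
            linarith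
          obtain ⟨e, he, hmin⟩ := Finset.exists_min_image _ G hne
          refine ⟨e, fun _ => ⟨by simpa using he, fun e' he' => hmin e' (by simpa using he')⟩⟩
        · exact ⟨d, fun h => absurd h hd⟩
      choose nxt hn using hnxt
      have h1 : ∑ d, μ d * G (nxt d) ≤ ∑ d, μ d * G d := by
        calc ∑ d, μ d * G (nxt d) = ∑ d, ∑ e, Q d e * G (nxt d) := by
              refine Finset.sum_congr rfl fun d _ => ?_
              rw [← Finset.sum_mul, hrow]
          _ ≤ ∑ d, ∑ e, Q d e * G e := by
              refine Finset.sum_le_sum fun d _ => Finset.sum_le_sum fun e _ => ?_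
              rcases (hQ d e).eq_or_lt with h | h
              · simp [← h]
              · have hd : 0 < μ d := lt_of_lt_of_le h (by
                  rw [← hrow]
                  exact Finset.single_le_sum (f := Q d) (fun e _ => hQ d e) (Finset.mem_univ e))
                exact mul_le_mul_of_nonneg_left ((hn d hd).2 e h) h.le
          _ = ∑ d, μ d * G d := by
              rw [Finset.sum_comm]
              refine Finset.sum_congr rfl fun d _ => ?_
              rw [← Finset.sum_mul, hcol]
      obtain ⟨d, hd1, hd2, hd3⟩ := ih (fun d => w d + G (nxt d)) (by
        have e1 : ∑ d, μ d * (m * w d + (w d + G (nxt d)))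
            = ∑ d, μ d * ((m + 1) * w d) + ∑ d, μ d * G (nxt d) := by
          rw [← Finset.sum_add_distrib]
          exact Finset.sum_congr rfl fun d _ => by ring
        have e2 : ∑ d, μ d * (((m + 1 : ℕ) : ℝ) * w d + G d)
            = ∑ d, μ d * ((m + 1) * w d) + ∑ d, μ d * G d := by
          rw [← Finset.sum_add_distrib]
          exact Finset.sum_congr rfl fun d _ => by push_cast; ring
        rw [e1]; rw [e2] at hG; linarith)
      have hmn := hn _ hd2
      refine ⟨fun j => if j ≤ m then d j else nxt (d m), ?_, ?_, ?_⟩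
      · intro j hj
        rcases Nat.lt_succ_iff_lt_or_eq.1 hj with h | rfl
        · simpa [h.le, Nat.succ_le_iff.2 h] using hd1 j h
        · simpa using hmn.1
      · simp only [show ¬ (m + 1 ≤ m) by omega, if_false]
        refine lt_of_lt_of_le hmn.1 ?_
        rw [← hcol]
        exact Finset.single_le_sum (f := fun e => Q e (nxt (d m))) (fun e _ => hQ e _)
          (Finset.mem_univ _)
      · rw [Finset.sum_range_succ]
        simp only [show ¬ (m + 1 ≤ m) by omega, if_false, le_refl, if_true]
        rw [Finset.sum_congr rfl (g := fun j => w (d j))]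
        · linarith
        · intro j hj
          rw [if_pos (Finset.mem_range.1 hj).le]
  obtain ⟨d, h1, -, h2⟩ := key (fun _ => 0) (by
    have : ∑ d, μ d * (m * w d + 0) = m * ∑ d, μ d * w d := by
      rw [Finset.mul_sum]; exact Finset.sum_congr rfl fun d _ => by ring
    rw [this]
    exact mul_nonpos_of_nonneg_of_nonpos (Nat.cast_nonneg m) hw)
  exact ⟨d, h1, by simpa using h2⟩

/-! ### The transmitted path and the flow off this path -/

section Flow

variable {k n : ℕ} {deg : Fin k → ℕ}

/-- The state of the accumulator at time `s`. -/
def trellisState (π : Interleaver deg n) (u : Fin k → ZMod 2) (s : Fin (n + 1)) : ZMod 2 :=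
  ∑ j : Fin n with j.val < s.val, u (owner π j)

variable (π : Interleaver deg n) (u : Fin k → ZMod 2)

theorem trellisState_zero : trellisState π u 0 = 0 := by
  simp [trellisState]

theorem trellisState_succ (i : Fin n) :
    trellisState π u i.succ = trellisState π u i.castSucc + u (owner π i) := by
  rw [trellisState, trellisState]
  have : (Finset.univ.filter fun j : Fin n => j.val < i.succ.val)
      = insert i (Finset.univ.filter fun j : Fin n => j.val < i.castSucc.val) := by
    ext j
    simp only [Fin.val_succ, Fin.val_castSucc, Finset.mem_filter, Finset.mem_univ, true_and,
      Finset.mem_insert, Fin.ext_iff]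
    omega
  rw [this, Finset.sum_insert (by simp), add_comm]

theorem encode_eq_trellisState (i : Fin n) : encode π u i = trellisState π u i.succ := by
  rw [encode, trellisState]
  refine Finset.sum_congr ?_ fun _ _ => rfl
  ext j
  simp only [Finset.mem_Iic, Fin.le_def, Finset.mem_filter, Finset.mem_univ, true_and,
    Fin.val_succ]
  omega

/-- Every information bit enters the accumulator an even number of times. Hence the transmitted path
ends at the sink of the flow. -/
theorem trellisState_last (hdeg : ∀ t, Even (deg t)) : trellisState π u (Fin.last n) = 0 := by
  have h1 : trellisState π u (Fin.last n) = ∑ j, u (owner π j) := by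
    simp [trellisState]
  rw [h1, ← Equiv.sum_comp π]
  simp only [owner, Equiv.symm_apply_apply]
  rw [Fintype.sum_sigma]
  refine Finset.sum_eq_zero fun t _ => ?_
  obtain ⟨r, hr⟩ := hdeg t
  simp only [Finset.sum_const, Finset.card_univ, Fintype.card_fin, hr, nsmul_eq_mul]
  push_cast
  rw [CharTwo.add_self_eq_zero, zero_mul]

theorem zmod_two_cases (z : ZMod 2) : z = 0 ∨ z = 1 := by
  revert z; decide

theorem outFlow_castSucc (f : TrellisEdge n → ℝ) (i : Fin n) (a : ZMod 2) :
    outFlow f (i.castSucc, a) = f (i, a, 0) + f (i, a, 1) := by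
  have : (Finset.univ.filter fun e : TrellisEdge n => e.source = (i.castSucc, a))
      = {(i, a, 0), (i, a, 1)} := by
    ext ⟨j, p, b⟩
    rcases zmod_two_cases b with rfl | rfl <;> simp [TrellisEdge.source]
  rw [outFlow, this, Finset.sum_pair (by simp)]

theorem outFlow_last (f : TrellisEdge n → ℝ) (a : ZMod 2) :
    outFlow f (Fin.last n, a) = 0 := by
  rw [outFlow]
  refine Finset.sum_eq_zero fun e he => ?_
  simp only [TrellisEdge.source, Finset.mem_filter, Finset.mem_univ, true_and,
    Prod.mk.injEq] at he
  exact absurd he.1 (Fin.castSucc_ne_last _)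

theorem inFlow_succ (f : TrellisEdge n → ℝ) (i : Fin n) (b : ZMod 2) :
    inFlow f (i.succ, b) = f (i, 0, b) + f (i, 1, b) := by
  have : (Finset.univ.filter fun e : TrellisEdge n => e.target = (i.succ, b))
      = {(i, 0, b), (i, 1, b)} := by
    ext ⟨j, p, b'⟩
    rcases zmod_two_cases p with rfl | rfl <;> simp [TrellisEdge.target]
  rw [inFlow, this, Finset.sum_pair (by simp)]

theorem inFlow_zero (f : TrellisEdge n → ℝ) (b : ZMod 2) : inFlow f (0, b) = 0 := by
  rw [inFlow]
  refine Finset.sum_eq_zero fun e he => ?_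
  simp only [TrellisEdge.target, Finset.mem_filter, Finset.mem_univ, true_and,
    Prod.mk.injEq] at he
  exact absurd he.1 (Fin.succ_ne_zero _)

theorem sum_inputOneEdges (f : TrellisEdge n → ℝ) (i : Fin n) :
    ∑ e ∈ inputOneEdges i, f e = f (i, 0, 1) + f (i, 1, 0) := by
  rw [inputOneEdges, Finset.sum_pair (by simp)]

/-- The unit flow along the path of the transmitted word. -/
def pathFlow (e : TrellisEdge n) : ℝ :=
  if e.2.1 = trellisState π u e.1.castSucc ∧ e.2.2 = trellisState π u e.1.succ then 1 else 0

theorem pathFlow_feasible (hdeg : ∀ t, Even (deg t)) (hn : 0 < n) :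
    IsFeasible π (pathFlow π u) (fun t => ((u t).val : ℝ)) := by
  have hout : ∀ (i : Fin n) a, outFlow (pathFlow π u) (i.castSucc, a)
      = if a = trellisState π u i.castSucc then 1 else 0 := by
    intro i a
    rw [outFlow_castSucc]
    rcases zmod_two_cases (trellisState π u i.succ) with h | h <;> simp [pathFlow, h]
  have hin : ∀ (i : Fin n) a, inFlow (pathFlow π u) (i.succ, a)
      = if a = trellisState π u i.succ then 1 else 0 := by
    intro i a
    rw [inFlow_succ]
    rcases zmod_two_cases (trellisState π u i.castSucc) with h | h <;> simp [pathFlow, h]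
  refine ⟨?_, ?_, ?_, ?_⟩
  · have := hout ⟨0, hn⟩ 0
    have h0 : (⟨0, hn⟩ : Fin n).castSucc = 0 := rfl
    rw [h0, trellisState_zero] at this
    simpa using this
  · rintro ⟨s, a⟩ h0 hl
    rcases Fin.eq_castSucc_or_eq_last s with ⟨i, rfl⟩ | rfl
    · rw [hout]
      rcases Fin.eq_zero_or_eq_succ i.castSucc with h | ⟨j, hj⟩
      · rw [h, inFlow_zero, trellisState_zero, if_neg]
        rintro rfl; exact h0 (by rw [h])
      · rw [hj, hin]
    · rw [outFlow_last]
      rcases Fin.eq_zero_or_eq_succ (Fin.last n) with h | ⟨j, hj⟩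
      · rw [h, inFlow_zero]
      · rw [hj, hin, ← hj, trellisState_last π u hdeg, if_neg]
        rintro rfl; exact hl rfl
  · intro t j
    rw [sum_inputOneEdges]
    have hs := trellisState_succ π u (π ⟨t, j⟩)
    have ho : owner π (π ⟨t, j⟩) = t := by simp [owner]
    rw [ho] at hs
    simp only [pathFlow, hs]
    rcases zmod_two_cases (trellisState π u (π ⟨t, j⟩).castSucc) with h | h <;>
      rcases zmod_two_cases (u t) with h' | h' <;> simp [h, h', ZMod.val_one,
        show (1 + 1 : ZMod 2) = 0 from rfl]
  · intro e
    rw [pathFlow]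
    split_ifs <;> norm_num

variable {π} {f : TrellisEdge n → ℝ} {x : Fin k → ℝ}

theorem IsFeasible.total (h : IsFeasible π f x) (i : Fin n) :
    f (i, 0, 0) + f (i, 0, 1) + f (i, 1, 0) + f (i, 1, 1) = 1 := by
  obtain ⟨i, hi⟩ := i
  induction i with
  | zero =>
    have h0 : (⟨0, hi⟩ : Fin n).castSucc = 0 := rfl
    have h1 := h.unit_flow
    rw [← h0, outFlow_castSucc] at h1
    have h2 := h.conservation (0, 1) (by simp) (by simp)
    rw [inFlow_zero, ← h0, outFlow_castSucc] at h2
    linarith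
  | succ i ih =>
    have ih := ih (by omega)
    have h0 : (⟨i + 1, hi⟩ : Fin n).castSucc = (⟨i, by omega⟩ : Fin n).succ := rfl
    have hc : ∀ a, outFlow f ((⟨i + 1, hi⟩ : Fin n).castSucc, a)
        = inFlow f ((⟨i, by omega⟩ : Fin n).succ, a) := by
      intro a
      rw [← h0]
      refine h.conservation _ ?_ ?_
      · intro h; rw [Prod.mk.injEq, Fin.ext_iff] at h; simp at h
      · intro h; rw [Prod.mk.injEq, Fin.ext_iff] at h; simp at h; omega
    have h1 := hc 0
    have h2 := hc 1
    rw [outFlow_castSucc, inFlow_succ] at h1 h2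
    linarith

theorem IsFeasible.input (h : IsFeasible π f x) (i : Fin n) :
    x (owner π i) = f (i, 0, 1) + f (i, 1, 0) := by
  have := h.agreeable (π.symm i).1 (π.symm i).2
  rw [sum_inputOneEdges] at this
  simpa [owner] using this

end Flow
/-! ### The walk of the flow off the transmitted path -/

section Darts

variable {k N : ℕ} {deg : Fin k → ℕ}

/-- A dart `(v, true)` leaves the vertex `v` towards `v + 1`, and `(v, false)` towards `v - 1`.
The Hamiltonian line is closed up to a cycle by an edge which will never carry flow. -/
abbrev Dart (N : ℕ) : Type := Fin (N + 1) × Bool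

/-- The dart in the opposite direction. -/
def Dart.rev : Dart N → Dart N
  | (v, true) => (v + 1, false)
  | (v, false) => (v - 1, true)

/-- The other dart which leaves the same vertex. -/
def Dart.flip (d : Dart N) : Dart N := (d.1, !d.2)

/-- The index of the code bit which belongs to the edge of a dart. -/
def Dart.bit : Dart N → Fin (N + 1)
  | (v, true) => v
  | (v, false) => v - 1

/-- The dart does not belong to the edge that closes the cycle. -/
def Dart.OnLine : Dart N → Prop
  | (v, true) => v.val < N
  | (v, false) => 0 < v.val

theorem Dart.rev_rev (d : Dart N) : d.rev.rev = d := by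
  rcases d with ⟨v, _ | _⟩ <;> simp [Dart.rev]

theorem Dart.flip_flip (d : Dart N) : d.flip.flip = d := by
  simp [Dart.flip]

/-- `d'` may follow `d` in a walk: it continues `d` in the same direction, or starts at another
vertex of the hyperedge at the head of `d`. -/
def Dart.Next (π : Interleaver deg (N + 1)) (d d' : Dart N) : Prop :=
  d' = d.rev.flip ∨ (d.rev.1 ≠ d'.1 ∧ owner π d.rev.1 = owner π d'.1)

variable (π : Interleaver deg (N + 1)) (u : Fin k → ZMod 2) (f : TrellisEdge (N + 1) → ℝ)

/-- The flow off the transmitted path before and after segment `v`. -/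
def through (v : Fin (N + 1)) : ℝ :=
  f (v, trellisState π u v.castSucc + 1, trellisState π u v.succ + 1)

/-- The flow which leaves the transmitted path in segment `d.1` (for `d.2 = true`), or which
returns to it (for `d.2 = false`). -/
def turnFlow (d : Dart N) : ℝ :=
  if d.2 then f (d.1, trellisState π u d.1.castSucc, trellisState π u d.1.succ + 1)
  else f (d.1, trellisState π u d.1.castSucc + 1, trellisState π u d.1.succ)

/-- The flow off the transmitted path on the edge of a dart. -/
def offFlow (d : Dart N) : ℝ := through π u f d.1 + turnFlow π u f d

/-- The flow off the transmitted path on the input bit of a segment. -/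
def inputFlow (v : Fin (N + 1)) : ℝ := turnFlow π u f (v, true) + turnFlow π u f (v, false)

theorem card_owner (t : Fin k) :
    (Finset.univ.filter fun v => owner π v = t).card = deg t := by
  have h : (Finset.univ.filter fun v => owner π v = t)
      = (Finset.univ : Finset (Fin (deg t))).map
        ⟨fun j => π ⟨t, j⟩, fun j j' h => by simpa using h⟩ := by
    ext v
    rw [Finset.mem_filter, Finset.mem_map]
    constructor
    · rintro ⟨-, rfl⟩; exact ⟨(π.symm v).2, Finset.mem_univ _, π.apply_symm_apply v⟩
    · rintro ⟨j, -, rfl⟩; exact ⟨Finset.mem_univ _, congrArg Sigma.fst (π.symm_apply_apply ⟨t, j⟩)⟩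
  rw [h, Finset.card_map, Finset.card_univ, Fintype.card_fin]

variable {π u f} {x : Fin k → ℝ}

theorem turnFlow_nonneg (h : IsFeasible π f x) (d : Dart N) : 0 ≤ turnFlow π u f d := by
  rw [turnFlow]; split_ifs <;> exact (h.bounds _).1

theorem through_nonneg (h : IsFeasible π f x) (v : Fin (N + 1)) : 0 ≤ through π u f v :=
  (h.bounds _).1

theorem inputFlow_nonneg (h : IsFeasible π f x) (v : Fin (N + 1)) : 0 ≤ inputFlow π u f v :=
  add_nonneg (turnFlow_nonneg h _) (turnFlow_nonneg h _)

theorem sum_states (F : ZMod 2 → ℝ) (a : ZMod 2) : F a + F (a + 1) = F 0 + F 1 := by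
  rcases zmod_two_cases a with rfl | rfl
  · simp
  · rw [show (1 + 1 : ZMod 2) = 0 from rfl, add_comm]

/-- The turning edges of a segment are exactly those whose input bit differs from the transmitted
one, so agreeability fixes their total flow for the whole hyperedge. -/
theorem inputFlow_eq (h : IsFeasible π f x) (v : Fin (N + 1)) :
    inputFlow π u f v = if u (owner π v) = 0 then x (owner π v) else 1 - x (owner π v) := by
  have ht := h.total v
  rw [h.input v, inputFlow, turnFlow, turnFlow, trellisState_succ]
  have h11 : (1 + 1 : ZMod 2) = 0 := rfl
  rcases zmod_two_cases (trellisState π u v.castSucc) with h1 | h1 <;>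
    rcases zmod_two_cases (u (owner π v)) with h2 | h2 <;>
    simp only [h1, h2, h11, if_true, zero_add, add_zero, one_ne_zero, if_false,
      Bool.false_eq_true] <;> linarith

theorem inputFlow_congr (h : IsFeasible π f x) {v w : Fin (N + 1)} (hvw : owner π v = owner π w) :
    inputFlow π u f v = inputFlow π u f w := by
  rw [inputFlow_eq h, inputFlow_eq h, hvw]

theorem offFlow_true (v : Fin (N + 1)) :
    offFlow π u f (v, true) = inFlow f (v.succ, trellisState π u v.succ + 1) := by
  rw [inFlow_succ, offFlow, turnFlow, through,
    ← sum_states (fun a => f (v, a, _)) (trellisState π u v.castSucc), if_pos rfl, add_comm]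

theorem offFlow_false (v : Fin (N + 1)) :
    offFlow π u f (v, false) = outFlow f (v.castSucc, trellisState π u v.castSucc + 1) := by
  rw [outFlow_castSucc, offFlow, turnFlow, through,
    ← sum_states (fun a => f (v, _, a)) (trellisState π u v.succ), if_neg (by simp), add_comm]

theorem offFlow_last (hdeg : ∀ t, Even (deg t)) (h : IsFeasible π f x) :
    offFlow π u f (Fin.last N, true) = 0 := by
  rw [offFlow_true, Fin.succ_last, trellisState_last π u hdeg, ← h.conservation _ _ _,
    outFlow_last]
  · intro h; exact absurd (Prod.ext_iff.1 h).1 (Fin.last_pos.ne')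
  · intro h; exact absurd (Prod.ext_iff.1 h).2 (by simp)

theorem offFlow_zero (h : IsFeasible π f x) : offFlow π u f (0, false) = 0 := by
  rw [offFlow_false, Fin.castSucc_zero, trellisState_zero, h.conservation _ _ _, inFlow_zero]
  · intro h; exact absurd (Prod.ext_iff.1 h).2 (by simp)
  · intro h; exact absurd (Prod.ext_iff.1 h).1 (Fin.last_pos.ne)

/-- Conservation at the off-path node between two segments. On the closing edge both sides vanish:
the off-path nodes at the two ends of the trellis are neither source nor sink. -/
theorem offFlow_succ (hdeg : ∀ t, Even (deg t)) (h : IsFeasible π f x) (v : Fin (N + 1)) :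
    offFlow π u f (v + 1, false) = offFlow π u f (v, true) := by
  rcases Fin.eq_castSucc_or_eq_last v with ⟨i, rfl⟩ | rfl
  · rw [Fin.coeSucc_eq_succ, offFlow_true, offFlow_false, Fin.succ_castSucc,
      h.conservation _ _ _]
    · intro h; exact absurd ((Fin.ext_iff.1 (Prod.ext_iff.1 h).1)) (by simp)
    · intro h
      exact absurd (Prod.ext_iff.1 h).1 (Fin.castSucc_ne_last _)
  · rw [Fin.last_add_one, offFlow_last hdeg h, offFlow_zero h]

theorem offFlow_rev (hdeg : ∀ t, Even (deg t)) (h : IsFeasible π f x) (d : Dart N) :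
    offFlow π u f d.rev = offFlow π u f d := by
  rcases d with ⟨v, _ | _⟩
  · rw [Dart.rev, ← offFlow_succ hdeg h, sub_add_cancel]
  · exact offFlow_succ hdeg h v

theorem onLine_of_offFlow_pos (hdeg : ∀ t, Even (deg t)) (h : IsFeasible π f x) {d : Dart N}
    (hd : 0 < offFlow π u f d) : d.OnLine := by
  rcases d with ⟨v, _ | _⟩
  · refine Nat.pos_of_ne_zero fun hv => ?_
    obtain rfl : v = 0 := Fin.ext hv
    rw [offFlow_zero h] at hd
    exact lt_irrefl _ hd
  · refine lt_of_le_of_ne (Nat.le_of_lt_succ v.2) fun hv => ?_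
    obtain rfl : v = Fin.last N := Fin.ext hv
    rw [offFlow_last hdeg h] at hd
    exact lt_irrefl _ hd

variable (π u f) in
/-- The flow from the edge of `e` to the edge of `d`, both of them leaving from vertices of the
same hyperedge. -/
noncomputable def jointFlow (e d : Dart N) : ℝ :=
  (if d = e.flip then through π u f e.1 else 0) +
  (if e.1 ≠ d.1 ∧ owner π e.1 = owner π d.1 then
    turnFlow π u f e * turnFlow π u f d / (((deg (owner π e.1) : ℝ) - 1) * inputFlow π u f e.1)
    else 0)

/-- The normalisation depends only on the common hyperedge. Symmetry is what turns row sums into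
column sums, so that the walk is stationary. -/
theorem jointFlow_symm (h : IsFeasible π f x) (e d : Dart N) :
    jointFlow π u f e d = jointFlow π u f d e := by
  rw [jointFlow, jointFlow]
  congr 1
  · by_cases hd : d = e.flip
    · subst hd; rw [if_pos rfl, if_pos (Dart.flip_flip e).symm]; rfl
    · rw [if_neg hd, if_neg]
      rintro rfl; exact hd (Dart.flip_flip d).symm
  · by_cases hd : e.1 ≠ d.1 ∧ owner π e.1 = owner π d.1
    · rw [if_pos hd, if_pos ⟨hd.1.symm, hd.2.symm⟩, hd.2, inputFlow_congr h hd.2, mul_comm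
        (turnFlow π u f e)]
    · rw [if_neg hd, if_neg fun hd' => hd ⟨hd'.1.symm, hd'.2.symm⟩]

theorem jointFlow_nonneg (hpos : ∀ t, 0 < deg t) (h : IsFeasible π f x) (e d : Dart N) :
    0 ≤ jointFlow π u f e d := by
  have h1 := hpos (owner π e.1)
  have h2 : (0 : ℝ) ≤ (deg (owner π e.1) : ℝ) - 1 := by
    rw [sub_nonneg]; exact_mod_cast h1
  refine add_nonneg ?_ ?_
  · split_ifs
    · exact through_nonneg h _
    · exact le_rfl
  · split_ifs
    · exact div_nonneg (mul_nonneg (turnFlow_nonneg h _) (turnFlow_nonneg h _))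
        (mul_nonneg h2 (inputFlow_nonneg h _))
    · exact le_rfl

/-- The turning flow of `e` is split equally among the `deg - 1` other vertices of the hyperedge,
and at each of them in proportion to its two turning flows, whose sum is the same `X` everywhere. -/
theorem sum_jointFlow (hdeg : ∀ t, 2 ≤ deg t) (h : IsFeasible π f x) (e : Dart N) :
    ∑ d, jointFlow π u f e d = offFlow π u f e := by
  simp only [jointFlow]
  rw [Finset.sum_add_distrib, Finset.sum_ite_eq' Finset.univ, if_pos (Finset.mem_univ _), offFlow]
  congr 1
  set X := inputFlow π u f e.1
  set q : ℝ := (deg (owner π e.1) : ℝ) - 1 with hq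
  have hq1 : q ≠ 0 := by
    have := hdeg (owner π e.1)
    have : (2 : ℝ) ≤ deg (owner π e.1) := by exact_mod_cast this
    rw [hq]; intro h; linarith
  have hin : ∀ w : Fin (N + 1), ∑ b : Bool, (if e.1 ≠ w ∧ owner π e.1 = owner π w then
      turnFlow π u f e * turnFlow π u f (w, b) / (q * X) else 0)
      = if e.1 ≠ w ∧ owner π e.1 = owner π w then turnFlow π u f e * X / (q * X) else 0 := by
    intro w
    by_cases hw : e.1 ≠ w ∧ owner π e.1 = owner π w
    · simp only [if_pos hw, Fintype.sum_bool]
      have : X = turnFlow π u f (w, true) + turnFlow π u f (w, false) := inputFlow_congr h hw.2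
      rw [← add_div, ← mul_add, ← this]
    · simp only [if_neg hw, Finset.sum_const_zero]
  rw [Fintype.sum_prod_type]
  simp only [hin]
  rw [← Finset.sum_filter, Finset.sum_const, nsmul_eq_mul]
  have hcard : ((Finset.univ.filter fun w => e.1 ≠ w ∧ owner π e.1 = owner π w).card : ℝ) = q := by
    have h1 : (Finset.univ.filter fun w => e.1 ≠ w ∧ owner π e.1 = owner π w)
        = (Finset.univ.filter fun w => owner π w = owner π e.1).erase e.1 := by
      ext w
      simp only [Finset.mem_filter, Finset.mem_univ, true_and, Finset.mem_erase, ne_comm,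
        eq_comm (a := owner π e.1)]
    rw [h1, Finset.card_erase_of_mem (by simp), card_owner, Nat.cast_sub]
    · simp [hq]
    · have := hdeg (owner π e.1); omega
  rw [hcard]
  -- If `X = 0` the quotients are `0` by convention, which is right since then nothing turns at this
  -- vertex.
  by_cases hX : X = 0
  · have h1 := turnFlow_nonneg (u := u) h (e.1, true)
    have h2 := turnFlow_nonneg (u := u) h (e.1, false)
    have h3 : turnFlow π u f (e.1, true) + turnFlow π u f (e.1, false) = 0 := hX
    have h4 : turnFlow π u f e = 0 := by
      rcases e with ⟨v, _ | _⟩ <;> simp only at * <;> linarith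
    simp [h4]
  · field_simp

end Darts
/-! ### The cost of the flow off the transmitted path -/

theorem ereal_sum_ne_bot {ι : Type*} (s : Finset ι) (t : ι → EReal) (h : ∀ i ∈ s, t i ≠ ⊥) :
    ∑ i ∈ s, t i ≠ ⊥ := by
  classical
  induction s using Finset.induction_on with
  | empty => simp
  | insert a s ha ih =>
    rw [Finset.sum_insert ha, Ne, EReal.add_eq_bot_iff, not_or]
    exact ⟨h a (Finset.mem_insert_self _ _), ih fun i hi => h i (Finset.mem_insert_of_mem hi)⟩

theorem ereal_ne_top_of_sum {ι : Type*} (s : Finset ι) (t : ι → EReal) (h : ∀ i ∈ s, t i ≠ ⊥)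
    (hs : ∑ i ∈ s, t i ≠ ⊤) : ∀ i ∈ s, t i ≠ ⊤ := by
  classical
  intro i hi hti
  rw [← Finset.add_sum_erase _ _ hi, hti, EReal.top_add_of_ne_bot] at hs
  · exact hs rfl
  · exact ereal_sum_ne_bot _ _ fun j hj => h j (Finset.mem_of_mem_erase hj)

theorem ereal_coe_sum {ι : Type*} (s : Finset ι) (r : ι → ℝ) :
    ((∑ i ∈ s, r i : ℝ) : EReal) = ∑ i ∈ s, (r i : EReal) := by
  classical
  induction s using Finset.induction_on with
  | empty => simp
  | insert a s ha ih => rw [Finset.sum_insert ha, Finset.sum_insert ha, EReal.coe_add, ih]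

theorem edgeCost_ne_bot (γ : EReal) (b : ZMod 2) : edgeCost γ b ≠ ⊥ := by
  rw [edgeCost]; split_ifs <;> simp_all

theorem edgeCost_mul_ne_bot (γ : EReal) (b : ZMod 2) {r : ℝ} (hr : 0 ≤ r) :
    edgeCost γ b * (r : EReal) ≠ ⊥ := by
  induction h : edgeCost γ b with
  | bot => exact absurd h (edgeCost_ne_bot γ b)
  | coe x => rw [← EReal.coe_mul]; exact EReal.coe_ne_bot _
  | top =>
    rcases hr.eq_or_lt with rfl | hr
    · simp
    · rw [EReal.top_mul_coe_of_pos hr]; simp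

section Objective

variable {k N : ℕ} {deg : Fin k → ℕ} {π : Interleaver deg (N + 1)} {u : Fin k → ZMod 2}
  {f : TrellisEdge (N + 1) → ℝ} {x : Fin k → ℝ}

theorem inFlow_on_path (h : IsFeasible π f x) (v : Fin (N + 1)) :
    inFlow f (v.succ, trellisState π u v.succ) = 1 - offFlow π u f (v, true) := by
  have := h.total v
  rw [offFlow_true, inFlow_succ, inFlow_succ]
  rcases zmod_two_cases (trellisState π u v.succ) with h | h
  · rw [h, zero_add]; linarith
  · rw [h, show (1 + 1 : ZMod 2) = 0 from rfl]; linarith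

/-- One unit crosses each segment and the cost sees only the output label, so compared with the
transmitted path only the off-path flow pays a difference. -/
theorem sum_edges (F : Fin (N + 1) → ZMod 2 → ℝ) (u : Fin k → ZMod 2) (h : IsFeasible π f x) :
    ∑ e : TrellisEdge (N + 1), F e.1 e.2.2 * f e = ∑ v, F v (trellisState π u v.succ) +
      ∑ v, (F v (trellisState π u v.succ + 1) - F v (trellisState π u v.succ)) *
        offFlow π u f (v, true) := by
  rw [Fintype.sum_prod_type, ← Finset.sum_add_distrib]
  refine Finset.sum_congr rfl fun v _ => ?_
  have h1 : ∑ p : ZMod 2 × ZMod 2, F v p.2 * f (v, p)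
      = F v (trellisState π u v.succ) * inFlow f (v.succ, trellisState π u v.succ) +
        F v (trellisState π u v.succ + 1) * inFlow f (v.succ, trellisState π u v.succ + 1) := by
    rw [sum_states fun a => F v a * inFlow f (v.succ, a), inFlow_succ, inFlow_succ,
      Fintype.sum_prod_type]
    have h2 : ∀ G : ZMod 2 → ℝ, ∑ a, G a = G 0 + G 1 := Fin.sum_univ_two
    simp only [h2]
    ring
  simp only at h1 ⊢
  rw [h1, inFlow_on_path h, ← offFlow_true]
  ring

theorem offFlow_pathFlow (v : Fin (N + 1)) : offFlow π u (pathFlow π u) (v, true) = 0 := by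
  rw [offFlow_true, inFlow_succ]
  simp [pathFlow]

theorem offFlow_nonneg (h : IsFeasible π f x) (d : Dart N) : 0 ≤ offFlow π u f d :=
  add_nonneg (through_nonneg h _) (turnFlow_nonneg h _)

/-- The log-likelihood ratios, with the sign that makes transmitted bits likely. -/
noncomputable def offCost (π : Interleaver deg (N + 1)) (u : Fin k → ZMod 2)
    (γ : Fin (N + 1) → EReal) (v : Fin (N + 1)) : EReal :=
  if encode π u v = 0 then γ v else -γ v

/-- The decoder's optimum has nonpositive cost off the transmitted path. -/
theorem exists_cost (hdeg : ∀ t, Even (deg t)) {γ : Fin (N + 1) → EReal}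
    (hγ : ∀ v, offCost π u γ v ≠ ⊥) {z : (TrellisEdge (N + 1) → ℝ) × (Fin k → ℝ)}
    (hz : IsOptimal π γ z) :
    ∃ δ : Fin (N + 1) → ℝ, (∀ v, 0 < offFlow π u z.1 (v, true) → offCost π u γ v = δ v) ∧
      ∑ v, offFlow π u z.1 (v, true) * δ v ≤ 0 := by
  obtain ⟨hf, hmin⟩ := hz
  have hopt := hmin _ _ (pathFlow_feasible π u hdeg N.succ_pos)
  set K : Fin (N + 1) → ZMod 2 → ℝ := fun v b => (edgeCost (γ v) b).toReal with hK
  set st := fun v : Fin (N + 1) => trellisState π u v.succ with hst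
  -- `hγ` excludes exactly the LLRs for which the transmitted label has infinite cost.
  have hcfin : ∀ v, edgeCost (γ v) (st v) ≠ ⊤ := by
    intro v
    have := hγ v
    rw [offCost, encode_eq_trellisState] at this
    change (if st v = 0 then γ v else -γ v) ≠ ⊥ at this
    rw [edgeCost]
    rcases zmod_two_cases (st v) with h | h
    · rw [h, if_pos rfl] at this
      simp [h, this]
    · rw [h, if_neg one_ne_zero] at this
      have : γ v ≠ ⊤ := fun h => this (by rw [h]; rfl)
      rw [h, if_pos rfl, if_pos rfl]
      split_ifs <;> simp [this]
  have hreal : ∀ {g : TrellisEdge (N + 1) → ℝ}, (∀ e, 0 ≤ g e) →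
      (∀ e, edgeCost (γ e.1) e.2.2 * (g e : EReal) ≠ ⊤) →
      objective γ g = ((∑ e : TrellisEdge (N + 1), K e.1 e.2.2 * g e : ℝ) : EReal) := by
    intro g hg ht
    rw [objective, ereal_coe_sum]
    refine Finset.sum_congr rfl fun e _ => ?_
    rw [← EReal.coe_toReal (ht e) (edgeCost_mul_ne_bot _ _ (hg e)), EReal.toReal_mul,
      EReal.toReal_coe]
  have hpath : ∀ e : TrellisEdge (N + 1),
      edgeCost (γ e.1) e.2.2 * (pathFlow π u e : EReal) ≠ ⊤ := by
    intro e
    rw [pathFlow]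
    split_ifs with he
    · rw [he.2, EReal.coe_one, mul_one]; exact hcfin e.1
    · simp
  rw [hreal (fun e => ((pathFlow_feasible π u hdeg N.succ_pos).bounds e).1) hpath] at hopt
  -- The transmitted path has finite cost, so the optimum does too and puts no flow on edges of
  -- infinite cost. Both objectives may then be compared in `ℝ`.
  have hne : ∀ e : TrellisEdge (N + 1), edgeCost (γ e.1) e.2.2 * (z.1 e : EReal) ≠ ⊤ := by
    intro e
    refine ereal_ne_top_of_sum Finset.univ _
      (fun e _ => edgeCost_mul_ne_bot (γ e.1) e.2.2 (hf.bounds e).1) ?_ e (Finset.mem_univ e)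
    exact ne_top_of_le_ne_top (EReal.coe_ne_top _) hopt
  rw [hreal (fun e => (hf.bounds e).1) hne, EReal.coe_le_coe_iff, sum_edges K u hf,
    sum_edges K u (pathFlow_feasible π u hdeg N.succ_pos)] at hopt
  simp only [offFlow_pathFlow, mul_zero, Finset.sum_const_zero, add_zero] at hopt
  refine ⟨fun v => K v (st v + 1) - K v (st v), ?_, ?_⟩
  · intro v hv
    have hKtop : edgeCost (γ v) (st v + 1) ≠ ⊤ := by
      intro htop
      rw [offFlow_true, inFlow_succ] at hv
      have hz0 : ∀ a, z.1 (v, a, st v + 1) = 0 := by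
        intro a
        by_contra hne0
        have hpos := lt_of_le_of_ne (hf.bounds (v, a, st v + 1)).1 (Ne.symm hne0)
        refine hne (v, a, st v + 1) ?_
        simp only [htop]
        exact EReal.top_mul_coe_of_pos hpos
      have h0 := hz0 0
      have h1 := hz0 1
      simp only [hst] at h0 h1
      rw [h0, h1] at hv
      simp at hv
    have hγv := hγ v
    rw [offCost, encode_eq_trellisState] at hγv ⊢
    change (if st v = 0 then γ v else -γ v) ≠ ⊥ at hγv
    change (if st v = 0 then γ v else -γ v) = _
    simp only [hK]
    rcases zmod_two_cases (st v) with h | h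
    · rw [h, if_pos rfl] at hγv
      rw [h, zero_add] at hKtop
      rw [edgeCost, if_neg hγv, if_pos rfl] at hKtop
      rw [h, if_pos rfl, zero_add, edgeCost, edgeCost, if_neg hγv, if_pos rfl, if_neg hγv,
        if_neg zero_ne_one, EReal.toReal_zero, sub_zero, EReal.coe_toReal hKtop hγv]
    · rw [h, if_neg one_ne_zero] at hγv
      have hγt : γ v ≠ ⊤ := fun h => hγv (by rw [h]; rfl)
      have h11 : (1 + 1 : ZMod 2) = 0 := rfl
      rw [h, h11] at hKtop
      have hγb : γ v ≠ ⊥ := fun hb => hKtop (by simp [edgeCost, hb])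
      rw [h, if_neg one_ne_zero, h11, edgeCost, edgeCost, if_neg hγb, if_neg hγb,
        if_neg zero_ne_one, if_pos rfl, EReal.toReal_zero, zero_sub, EReal.coe_neg,
        EReal.coe_toReal hγt hγb]
  · refine le_trans (le_of_eq (Finset.sum_congr rfl fun v _ => mul_comm _ _)) ?_
    simp only [hst]
    linarith

/-- A feasible point without flow off the transmitted path is the transmitted word. -/
theorem ralpOutput_of_offFlow_eq_zero (hdeg : ∀ t, Even (deg t)) (hpos : ∀ t, 0 < deg t)
    {z : (TrellisEdge (N + 1) → ℝ) × (Fin k → ℝ)} (hz : IsFeasible π z.1 z.2)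
    (h0 : ∀ d : Dart N, offFlow π u z.1 d = 0) :
    ralpOutput z = some fun t => ((u t).val : ℝ) := by
  have h1 : ∀ v, through π u z.1 v = 0 := fun v => by
    have := h0 (v, true)
    have h1 := through_nonneg (u := u) hz v
    have h2 := turnFlow_nonneg (u := u) hz (v, true)
    rw [offFlow] at this
    linarith
  have h2 : ∀ d : Dart N, turnFlow π u z.1 d = 0 := fun d => by
    have := h0 d
    rw [offFlow, h1, zero_add] at this
    exact this
  have hpf : z.1 = pathFlow π u := by
    funext ⟨v, a, b⟩
    have e1 := h1 v
    have e2 := h2 (v, true)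
    have e3 := h2 (v, false)
    have ht := hz.total v
    simp only [through, turnFlow, if_true, Bool.false_eq_true, if_false] at e1 e2 e3
    have h11 : (1 + 1 : ZMod 2) = 0 := rfl
    rcases zmod_two_cases (trellisState π u v.castSucc) with hp | hp <;>
    rcases zmod_two_cases (trellisState π u v.succ) with hq | hq <;>
    rcases zmod_two_cases a with rfl | rfl <;>
    rcases zmod_two_cases b with rfl | rfl <;>
    simp only [hp, hq, h11, zero_add] at e1 e2 e3 <;>
    simp only [pathFlow, hp, hq, zero_ne_one, one_ne_zero, and_true, and_false,
      if_true, if_false] <;> linarith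
  have hx : z.2 = fun t => ((u t).val : ℝ) := by
    funext t
    rw [hz.agreeable t ⟨0, hpos t⟩, hpf,
      ← (pathFlow_feasible π u hdeg N.succ_pos).agreeable t ⟨0, hpos t⟩]
  rw [ralpOutput, if_pos, hx]
  intro e
  rw [hpf, pathFlow]
  split_ifs <;> simp

/-- If the decoder fails, then there is a walk of nonpositive cost. -/
theorem exists_cheap_walk (hdeg : ∀ t, Even (deg t)) (hpos : ∀ t, 0 < deg t)
    {γ : Fin (N + 1) → EReal} (hγ : ∀ v, offCost π u γ v ≠ ⊥)
    {z : (TrellisEdge (N + 1) → ℝ) × (Fin k → ℝ)} (hz : IsOptimal π γ z)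
    (herr : ralpOutput z ≠ some fun t => ((u t).val : ℝ)) (m : ℕ) :
    ∃ d : ℕ → Dart N, (∀ j < m, (d j).OnLine ∧ Dart.Next π (d j) (d (j + 1))) ∧
      ∑ j ∈ Finset.range m, offCost π u γ (d j).bit ≤ 0 := by
  obtain ⟨δ, hδ, hsum⟩ := exists_cost hdeg hγ hz
  have hf := hz.1
  have hdeg2 : ∀ t, 2 ≤ deg t := fun t => by
    obtain ⟨r, hr⟩ := hdeg t
    have := hpos t
    omega
  have hbit : ∀ d : Dart N, offFlow π u z.1 (d.bit, true) = offFlow π u z.1 d := by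
    rintro ⟨v, _ | _⟩
    · exact offFlow_rev hdeg hf (v, false)
    · rfl
  obtain ⟨d, hd, hcost⟩ := exists_chain_sum_nonpos (offFlow π u z.1) (fun d => δ d.bit)
    (fun d d' => jointFlow π u z.1 d.rev d') (fun d d' => jointFlow_nonneg hpos hf _ _)
    (fun d => by rw [sum_jointFlow hdeg2 hf, offFlow_rev hdeg hf])
    (fun d' => by
      -- Column sums: reversal permutes the darts, and symmetry turns the sum into a row sum.
      rw [← sum_jointFlow hdeg2 hf d', ← Equiv.sum_comp ⟨Dart.rev, Dart.rev, Dart.rev_rev,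
        Dart.rev_rev⟩ (fun d => jointFlow π u z.1 d' d)]
      exact Finset.sum_congr rfl fun d _ => jointFlow_symm hf _ _)
    (by
      rw [Fintype.sum_prod_type]
      simp only [Fintype.sum_bool, Finset.sum_add_distrib]
      -- Each Hamiltonian edge occurs in both directions with equal flow, so the mean cost is twice
      -- the sum in `hsum`.
      have h1 : ∑ v, offFlow π u z.1 (v, false) * δ (Dart.bit (v, false))
          = ∑ v, offFlow π u z.1 (v, true) * δ v := by
        rw [← Equiv.sum_comp (Equiv.addRight (1 : Fin (N + 1)))]
        refine Finset.sum_congr rfl fun v _ => ?_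
        simp only [Equiv.coe_addRight, Dart.bit, add_sub_cancel_right, offFlow_succ hdeg hf]
      rw [h1]
      simp only [Dart.bit]
      linarith)
    (by
      by_contra! hcon
      exact herr (ralpOutput_of_offFlow_eq_zero hdeg hpos hf fun d =>
        le_antisymm (hcon d) (offFlow_nonneg hf d))) m
  have hoff : ∀ j < m, 0 < offFlow π u z.1 (d j) := by
    intro j hj
    refine lt_of_lt_of_le (hd j hj) ?_
    rw [← offFlow_rev hdeg hf, ← sum_jointFlow hdeg2 hf]
    exact Finset.single_le_sum (f := jointFlow π u z.1 (d j).rev)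
      (fun _ _ => jointFlow_nonneg hpos hf _ _) (Finset.mem_univ _)
  refine ⟨d, fun j hj => ⟨onLine_of_offFlow_pos hdeg hf (hoff j hj), ?_⟩, ?_⟩
  · by_contra hnot
    rw [Dart.Next, not_or] at hnot
    have := hd j hj
    simp only [jointFlow, if_neg hnot.1, if_neg hnot.2, add_zero, lt_irrefl] at this
  · rw [Finset.sum_congr rfl (g := fun j => ((δ (d j).bit : ℝ) : EReal)), ← ereal_coe_sum]
    · exact_mod_cast hcost
    · intro j hj
      exact hδ _ (by rw [hbit]; exact hoff j (Finset.mem_range.1 hj))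

end Objective
-- Walks, girth and the number of walks
section Walks

variable {k N : ℕ} {deg : Fin k → ℕ} {π : Interleaver deg (N + 1)}

theorem Trail.exists_auxPath {n : ℕ} {π : Interleaver deg n} {x y : Fin n} {e f : AuxEdge n k}
    {l : ℕ} (h : Trail (fun v => some (owner π v)) x e y f l) :
    ∃ p ε, IsAuxPath π l p ε ∧ p 0 = x ∧ p l = y ∧ ε 0 = e := by
  have hs : ∀ {e x y}, IsStep (fun v => some (owner π v)) e x y →
      x ∈ e.verts π ∧ y ∈ e.verts π ∧ x ≠ y := by
    intro e x y h
    refine ⟨?_, ?_, h.ne⟩ <;> cases e with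
    | ham i => simp only [IsStep] at h; change _ ∨ _; omega
    | hyper t =>
      have h1 := h.1
      have h2 := h.2.1
      simp only [Option.some.injEq] at h1 h2
      first | exact h1 | exact h2
  induction h with
  | @single x e y h =>
    refine ⟨fun j => Nat.casesOn j x fun _ => y, fun _ => e, ⟨fun j hj => ?_, fun j hj => ?_⟩,
      rfl, rfl, rfl⟩
    · obtain rfl : j = 0 := by omega
      exact hs h
    · omega
  | @cons x e y e' z f l h hne _ ih =>
    obtain ⟨p, ε, hp, hp0, hpl, hε⟩ := ih
    refine ⟨fun j => Nat.casesOn j x p, fun j => Nat.casesOn j e ε,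
      ⟨fun j hj => ?_, fun j hj => ?_⟩, rfl, hpl, rfl⟩
    · cases j with
      | zero =>
        change x ∈ e.verts π ∧ p 0 ∈ e.verts π ∧ x ≠ p 0
        rw [hp0]
        exact hs h
      | succ j => exact hp.step j (by omega)
    · cases j with
      | zero =>
        change e ≠ ε 0
        rw [hε]
        exact hne
      | succ j => exact hp.no_turn j (by omega)

theorem girthGE_of_le_auxGirth {n : ℕ} {π : Interleaver deg n} {g : ℕ}
    (h : (g : ℕ∞) ≤ auxGirth π) : GirthGE (fun v => some (owner π v)) g := by
  intro x e f l ht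
  obtain ⟨p, ε, hp, h0, hl, -⟩ := ht.exists_auxPath
  have : auxGirth π ≤ (l : ℕ∞) := iInf₂_le l ⟨ht.pos, p, ε, hp, by rw [h0, hl]⟩
  exact_mod_cast h.trans this

theorem Dart.val_succ_of_onLine {v : Fin (N + 1)} (h : Dart.OnLine (v, true)) :
    (v + 1).val = v.val + 1 := by
  have : v.val < N := h
  rw [Fin.val_add_one, if_neg]
  rintro rfl
  simp at this

theorem Dart.val_pred_of_onLine {v : Fin (N + 1)} (h : Dart.OnLine (v, false)) :
    (v - 1).val + 1 = v.val := by
  have h0 : 0 < v.val := h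
  have h1 : v - 1 ≠ Fin.last N := by
    intro h
    have : v = 0 := by rw [← sub_add_cancel v 1, h, Fin.last_add_one]
    rw [this] at h0
    simp at h0
  have h2 := Fin.val_add_one (v - 1)
  rw [sub_add_cancel, if_neg h1] at h2
  exact h2.symm

theorem Dart.OnLine.bit_lt {d : Dart N} (h : d.OnLine) : d.bit.val < N := by
  rcases d with ⟨v, _ | _⟩
  · have := Dart.val_pred_of_onLine h
    have h2 := v.2
    simp only [Dart.bit]
    omega
  · exact h

/-- The Hamiltonian edge of a dart. -/
def Dart.edge (k : ℕ) (d : Dart N) (h : d.OnLine) : AuxEdge (N + 1) k := .ham ⟨d.bit.val, h.bit_lt⟩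

theorem Dart.isStep (c : Fin (N + 1) → Option (Fin k)) {d : Dart N} (h : d.OnLine) :
    IsStep c (d.edge k h) d.1 d.rev.1 := by
  rcases d with ⟨v, _ | _⟩
  · exact .inr ⟨(Dart.val_pred_of_onLine h).symm, rfl⟩
  · exact .inl ⟨rfl, Dart.val_succ_of_onLine h⟩

theorem Dart.bit_straight_ne {d : Dart N} (h : d.OnLine) (h' : d.rev.flip.OnLine) :
    d.bit.val ≠ d.rev.flip.bit.val := by
  rcases d with ⟨v, _ | _⟩
  · have h2 := Dart.val_pred_of_onLine (v := v - 1) h'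
    simp only [Dart.bit, Dart.rev, Dart.flip, Bool.not_true]
    omega
  · have := Dart.val_succ_of_onLine h
    simp only [Dart.bit, Dart.rev, Dart.flip, Bool.not_false]
    omega

theorem Dart.eq_or_eq_rev_of_bit_eq {d d' : Dart N} (h : d.bit = d'.bit) :
    d' = d ∨ d' = d.rev := by
  rcases d with ⟨v, _ | _⟩ <;> rcases d' with ⟨w, _ | _⟩ <;> simp only [Dart.bit] at h
  · left; rw [sub_left_inj.1 h]
  · right; rw [Dart.rev, h]
  · right; rw [Dart.rev, h, sub_add_cancel]
  · left; rw [h]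

/-- Going straight needs no connecting edge, since the next Hamiltonian edge is a different one; a
jump inserts one hyperedge. In both cases `d'` can be appended without a turn. -/
theorem Trail.extend {x : Fin (N + 1)} {e : AuxEdge (N + 1) k} {d d' : Dart N} {l : ℕ}
    (hd : d.OnLine) (hd' : d'.OnLine) (hn : Dart.Next π d d')
    (ht : Trail (fun v => some (owner π v)) x e d.rev.1 (d.edge k hd) l) :
    ∃ f l', l' ≤ l + 1 ∧ Trail (fun v => some (owner π v)) x e d'.1 f l' ∧ f ≠ d'.edge k hd' := by
  rcases hn with rfl | ⟨h1, h2⟩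
  · refine ⟨_, l, by omega, ht, ?_⟩
    intro h
    simp only [Dart.edge, AuxEdge.ham.injEq, Fin.mk.injEq] at h
    exact Dart.bit_straight_ne hd hd' h
  · refine ⟨.hyper (owner π d'.1), l + 1, le_rfl, ht.snoc ⟨congrArg some h2, rfl, h1⟩ ?_, ?_⟩ <;>
      simp [Dart.edge]

theorem exists_trail_of_walk {d : ℕ → Dart N} {m : ℕ} (hl : ∀ j < m, (d j).OnLine)
    (hn : ∀ j < m, Dart.Next π (d j) (d (j + 1))) (a r : ℕ) (h : a + r + 1 < m) :
    ∃ f l, l ≤ 2 * (r + 1) ∧ Trail (fun v => some (owner π v)) (d a).1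
      ((d a).edge k (hl a (by omega))) (d (a + r + 1)).1 f l ∧
      f ≠ (d (a + r + 1)).edge k (hl _ h) := by
  induction r with
  | zero =>
    obtain ⟨f, l, h1, h2, h3⟩ := Trail.extend (hl a (by omega)) (hl (a + 1) (by omega))
      (hn a (by omega)) (.single (Dart.isStep _ (hl a (by omega))))
    exact ⟨f, l, by omega, h2, h3⟩
  | succ r ih =>
    obtain ⟨f, l, h1, h2, h3⟩ := ih (by omega)
    obtain ⟨f, l, h4, h5, h6⟩ := Trail.extend (hl (a + r + 1) (by omega)) (hl _ h)
      (hn _ (by omega)) (h2.snoc (Dart.isStep _ (hl (a + r + 1) (by omega))) h3)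
    exact ⟨f, l, by omega, h5, h6⟩

/-- The edges of a walk of at most half the girth are distinct. -/
theorem walk_bits_injective {d : ℕ → Dart N} {m g : ℕ} (hl : ∀ j < m, (d j).OnLine)
    (hn : ∀ j < m, Dart.Next π (d j) (d (j + 1))) (hg : (g : ℕ∞) ≤ auxGirth π)
    (hm : 2 * m ≤ g) : Function.Injective fun i : Fin m => (d i).bit := by
  have key : ∀ a b, a < b → b < m → (d a).bit ≠ (d b).bit := by
    intro a b hab hb heq
    obtain ⟨r, rfl⟩ : ∃ r, b = a + r + 1 := ⟨b - a - 1, by omega⟩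
    obtain ⟨f, l, h1, h2, h3⟩ := exists_trail_of_walk hl hn a r hb
    have hG := girthGE_of_le_auxGirth hg
    -- In the same direction the trail is already closed; in the opposite one, traversing the edge
    -- once more closes it. The length is at most `2 * (r + 1) + 1 ≤ 2 * m - 1 < g`.
    rcases Dart.eq_or_eq_rev_of_bit_eq heq with h | h
    · rw [congrArg Prod.fst h] at h2
      have := hG _ _ _ _ h2
      omega
    · have h4 := h2.snoc (Dart.isStep _ (hl _ hb)) h3
      have h5 : (d (a + r + 1)).rev.1 = (d a).1 := by rw [h, Dart.rev_rev]
      rw [h5] at h4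
      have := hG _ _ _ _ h4
      omega
  intro i j hij
  rcases lt_trichotomy i.val j.val with h | h | h
  · exact absurd hij (key _ _ h j.2)
  · exact Fin.ext h
  · exact absurd hij.symm (key _ _ h i.2)

open Classical in
theorem card_next {q : ℕ} (hq : ∀ t, deg t ≤ q) (hpos : ∀ t, 0 < deg t) (d : Dart N) :
    (Finset.univ.filter (Dart.Next π d)).card ≤ 2 * q - 1 := by
  have hsub : Finset.univ.filter (Dart.Next π d) ⊆ insert d.rev.flip
      (((Finset.univ.filter fun w => owner π w = owner π d.rev.1).erase d.rev.1) ×ˢ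
        (Finset.univ : Finset Bool)) := by
    intro d' hd'
    rcases (Finset.mem_filter.1 hd').2 with h | ⟨h1, h2⟩
    · exact Finset.mem_insert.2 (.inl h)
    · refine Finset.mem_insert_of_mem (Finset.mem_product.2 ⟨?_, Finset.mem_univ _⟩)
      exact Finset.mem_erase.2 ⟨h1.symm, by simp [h2]⟩
  refine (Finset.card_le_card hsub).trans ((Finset.card_insert_le _ _).trans ?_)
  rw [Finset.card_product, Finset.card_erase_of_mem (by simp), card_owner, Finset.card_univ,
    Fintype.card_bool]
  have h1 := hq (owner π d.rev.1)
  have h2 := hpos (owner π d.rev.1)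
  omega

/-- There are few walks. -/
theorem exists_walks {q : ℕ} (hq : ∀ t, deg t ≤ q) (hpos : ∀ t, 0 < deg t) (m : ℕ) :
    ∃ S : Finset (Fin (m + 1) → Dart N), S.card ≤ 2 * (N + 1) * (2 * q - 1) ^ m ∧
      ∀ d : ℕ → Dart N, (∀ j < m, Dart.Next π (d j) (d (j + 1))) →
        (fun i : Fin (m + 1) => d i) ∈ S := by
  classical
  induction m with
  | zero =>
    refine ⟨Finset.univ, ?_, fun d _ => Finset.mem_univ _⟩
    simp [mul_comm]
  | succ m ih =>
    obtain ⟨S, hS, hmem⟩ := ih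
    refine ⟨S.biUnion fun s => (Finset.univ.filter (Dart.Next π (s (Fin.last m)))).image
      fun d => Fin.snoc (α := fun _ => Dart N) s d, ?_, fun d hd => ?_⟩
    · refine (Finset.card_biUnion_le_card_mul _ _ _ fun s _ =>
        Finset.card_image_le.trans (card_next hq hpos _)).trans ?_
      rw [pow_succ, ← mul_assoc]
      exact Nat.mul_le_mul_right _ hS
    · refine Finset.mem_biUnion.2 ⟨fun i => d i, hmem d fun j hj => hd j (by omega),
        Finset.mem_image.2 ⟨d (m + 1), ?_, ?_⟩⟩
      · simpa using hd m (by omega)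
      · funext i
        refine Fin.lastCases ?_ (fun i => ?_) i
        · simp
        · simp

end Walks
-- Channel symmetry and the law of the log-likelihood ratios
namespace MBIOSChannel

variable {Y : Type*} [MeasurableSpace Y] (ch : MBIOSChannel Y)

theorem measurable_llr : Measurable ch.llr := by
  unfold llr
  have h := fun b => (ch.measurable_dens b).coe_nnreal_ennreal
  exact ENNReal.measurable_log.comp ((h 0).div (h 1))

instance : IsProbabilityMeasure ch.llrLaw :=
  Measure.isProbabilityMeasure_map ch.measurable_llr.aemeasurable

theorem law_one_map_flip : (ch.law 1).map ch.flip = ch.law 0 := by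
  have hf := ch.measurePreserving_flip
  ext s hs
  rw [Measure.map_apply hf.measurable hs, law, law, withDensity_apply _ hs,
    withDensity_apply _ (hf.measurable hs),
    ← hf.setLIntegral_comp_preimage hs (ch.measurable_dens 0).coe_nnreal_ennreal]
  simp only [ch.dens_flip]

/-- The output of the channel, flipped if the bit `1` was sent. -/
def unflip (b : ZMod 2) (y : Y) : Y := if b = 0 then y else ch.flip y

theorem measurable_unflip (b : ZMod 2) : Measurable (ch.unflip b) := by
  unfold unflip
  split_ifs
  · exact measurable_id
  · exact ch.measurePreserving_flip.measurable

theorem law_map_unflip (b : ZMod 2) : (ch.law b).map (ch.unflip b) = ch.law 0 := by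
  rcases zmod_two_cases b with rfl | rfl
  · have : ch.unflip 0 = id := by funext y; simp [unflip]
    rw [this, Measure.map_id]
  · have : ch.unflip 1 = ch.flip := by funext y; simp [unflip]
    rw [this, law_one_map_flip]

theorem law_dens_eq_zero (b : ZMod 2) : ch.law b {y | ch.dens b y = 0} = 0 := by
  have hm : MeasurableSet {y | ch.dens b y = 0} :=
    ch.measurable_dens b (measurableSet_singleton 0)
  rw [law, withDensity_apply _ hm, setLIntegral_congr_fun (g := fun _ => 0) hm, lintegral_zero]
  intro y hy
  have : ch.dens b y = 0 := hy
  simp [this]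

/-- Flipping exchanges the two densities and so inverts their ratio. A nonzero density of the sent
bit rules out `-∞`, as well as the ratio `0 / 0`, for which inversion would fail. -/
theorem llr_unflip {b : ZMod 2} {y : Y} (h : ch.dens b y ≠ 0) :
    ch.llr (ch.unflip b y) = (if b = 0 then ch.llr y else -ch.llr y) ∧
      ch.llr (ch.unflip b y) ≠ ⊥ := by
  rcases zmod_two_cases b with rfl | rfl
  · refine ⟨by simp [unflip], ?_⟩
    simp only [unflip, if_true, llr, Ne, ENNReal.log_eq_bot_iff, ENNReal.div_eq_zero_iff, not_or]
    exact ⟨by simpa using h, ENNReal.coe_ne_top⟩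
  · have h1 : ch.dens 0 (ch.flip y) = ch.dens 1 y := (ch.dens_flip y).symm
    have h2 : ch.dens 1 (ch.flip y) = ch.dens 0 y := by rw [ch.dens_flip, ch.flip_flip]
    simp only [unflip, one_ne_zero, if_false, llr, h1, h2]
    constructor
    · rw [← ENNReal.log_inv, ENNReal.inv_div (.inl ENNReal.coe_ne_top)
        (.inl (by simpa using h))]
    · simp only [Ne, ENNReal.log_eq_bot_iff, ENNReal.div_eq_zero_iff, not_or]
      exact ⟨by simpa using h, ENNReal.coe_ne_top⟩

/-- Otherwise `dens 0` vanishes almost everywhere where it is at most `dens 1`; by symmetry `dens 1`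
vanishes where it is at most `dens 0`. The two laws would then have disjoint supports. -/
theorem law_zero_llr_nonpos_pos (h : ¬ (ch.law 0).MutuallySingular (ch.law 1)) :
    0 < ch.llrLaw (Set.Iic 0) := by
  rw [llrLaw, Measure.map_apply ch.measurable_llr measurableSet_Iic, pos_iff_ne_zero]
  intro h0
  apply h
  have hm : ∀ b, Measurable fun y => (ch.dens b y : ℝ≥0∞) :=
    fun b => (ch.measurable_dens b).coe_nnreal_ennreal
  have hllr : ∀ y, ch.dens 0 y ≤ ch.dens 1 y → ch.llr y ∈ Set.Iic 0 := by
    intro y hy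
    simp only [llr, Set.mem_Iic, ENNReal.log_le_zero_iff]
    exact ENNReal.div_le_of_le_mul (by rw [one_mul]; exact_mod_cast hy)
  have h1 : ∀ᵐ y ∂ch.ref, ch.llr y ∈ Set.Iic 0 → ch.dens 0 y = 0 := by
    have : ∀ᵐ y ∂ch.law 0, ch.llr y ∉ Set.Iic 0 := by
      rw [ae_iff]; simp only [not_not]; exact h0
    rw [law, ae_withDensity_iff (hm 0)] at this
    filter_upwards [this] with y hy h
    by_contra hne
    exact hy (by simpa using hne) h
  have h2 := ch.measurePreserving_flip.quasiMeasurePreserving.ae h1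
  have hS : MeasurableSet {y | ch.dens 0 y = 0} :=
    ch.measurable_dens 0 (measurableSet_singleton 0)
  refine ⟨{y | ch.dens 0 y = 0}, hS, ch.law_dens_eq_zero 0, ?_⟩
  have h3 : ∀ᵐ y ∂ch.law 1, ch.dens 0 y = 0 := by
    rw [law, ae_withDensity_iff (hm 1)]
    filter_upwards [h1, h2] with y hy1 hy2 hne
    rcases le_total (ch.dens 0 y) (ch.dens 1 y) with hle | hle
    · exact hy1 (hllr y hle)
    · have := hy2 (hllr _ (by rwa [← ch.dens_flip, ch.dens_flip (ch.flip y), ch.flip_flip]))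
      rw [← ch.dens_flip] at this
      simp [this] at hne
  exact ae_iff.1 h3

theorem llrSumProb_pos (h : ¬ (ch.law 0).MutuallySingular (ch.law 1)) (m : ℕ) :
    0 < ch.llrSumProb m := by
  have hsub : (Set.univ.pi fun _ : Fin m => Set.Iic (0 : EReal)) ⊆ {z | ∑ i, z i ≤ 0} := by
    intro z hz
    exact Finset.sum_nonpos fun i _ => Set.mem_Iic.1 (hz i (Set.mem_univ i))
  refine lt_of_lt_of_le ?_ (measureReal_mono hsub)
  rw [measureReal_def, Measure.pi_pi, ENNReal.toReal_pos_iff]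
  constructor
  · rw [Finset.prod_const]
    exact ENNReal.pow_pos (ch.law_zero_llr_nonpos_pos h) _
  · exact ENNReal.prod_lt_top fun _ _ => measure_lt_top _ _

theorem llrSumProb_zero : ch.llrSumProb 0 = 1 := by
  simp [llrSumProb]

/-- The probability that given distinct bits are jointly unlikely. -/
theorem measure_sum_llr_le {ι : Type*} [Fintype ι] (b : ι → ZMod 2) {m : ℕ} (σ : Fin m → ι)
    (hσ : Function.Injective σ) :
    (Measure.pi fun i => ch.law (b i)).real
      {y | ∑ j, ch.llr (ch.unflip (b (σ j)) (y (σ j))) ≤ 0} ≤ ch.llrSumProb m := by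
  set μ := Measure.pi fun i => ch.law (b i) with hμ
  have hX : ∀ i, Measurable fun y => ch.llr (ch.unflip (b i) y) := fun i =>
    ch.measurable_llr.comp (ch.measurable_unflip (b i))
  have hXe : ∀ i, Measurable fun y : ι → Y => ch.llr (ch.unflip (b i) (y i)) := fun i =>
    (hX i).comp (measurable_pi_apply i)
  have hind : ProbabilityTheory.iIndepFun
      (fun i (y : ι → Y) => ch.llr (ch.unflip (b i) (y i))) μ :=
    ProbabilityTheory.iIndepFun_pi fun i => (hX i).aemeasurable
  have hind' := hind.precomp hσ
  rw [ProbabilityTheory.iIndepFun_iff_map_fun_eq_pi_map fun j => (hXe (σ j)).aemeasurable]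
    at hind'
  have hlaw : ∀ i, μ.map (fun y : ι → Y => ch.llr (ch.unflip (b i) (y i))) = ch.llrLaw := by
    intro i
    have h1 : (fun y : ι → Y => ch.llr (ch.unflip (b i) (y i)))
        = (ch.llr ∘ ch.unflip (b i)) ∘ Function.eval i := rfl
    rw [h1, ← Measure.map_map (ch.measurable_llr.comp (ch.measurable_unflip _))
      (measurable_pi_apply i), hμ,
      (measurePreserving_eval (fun i => ch.law (b i)) i).map_eq,
      ← Measure.map_map ch.measurable_llr (ch.measurable_unflip _), law_map_unflip, llrLaw]
  simp only [hlaw] at hind'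
  rw [llrSumProb, ← hind', measureReal_def, measureReal_def]
  refine ENNReal.toReal_mono (measure_ne_top _ _) ?_
  -- This inequality holds for arbitrary sets, so the event need not be shown measurable.
  exact Measure.le_map_apply
    (measurable_pi_lambda _ fun j => hXe (σ j)).aemeasurable {z : Fin m → EReal | ∑ i, z i ≤ 0}

end MBIOSChannel

/-! ### The union bound -/

section ErrorBound

variable {k : ℕ} {Y : Type*} [MeasurableSpace Y] {ch : MBIOSChannel Y}

theorem wordErrorProb_le_one {n : ℕ} {deg : Fin k → ℕ} {π : Interleaver deg n}
    {sol : (Fin n → Y) → (TrellisEdge n → ℝ) × (Fin k → ℝ)} {u : Fin k → ZMod 2} :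
    wordErrorProb ch π sol u ≤ 1 :=
  measureReal_le_one

theorem wordErrorProb_le_card {N : ℕ} {deg : Fin k → ℕ} {π : Interleaver deg (N + 1)}
    (hdeg : ∀ t, Even (deg t) ∧ 0 < deg t) {g q : ℕ} (hg : (g : ℕ∞) ≤ auxGirth π)
    (hq : ∀ t, deg t ≤ q)
    {sol : (Fin (N + 1) → Y) → (TrellisEdge (N + 1) → ℝ) × (Fin k → ℝ)}
    (hsol : IsRALPSolver ch π sol) (u : Fin k → ZMod 2) {m : ℕ} (hm : 2 * (m + 1) ≤ g) :
    wordErrorProb ch π sol u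
      ≤ ((2 * (N + 1) * (2 * q - 1) ^ m : ℕ) : ℝ) * ch.llrSumProb (m + 1) := by
  classical
  obtain ⟨S, hS, hmem⟩ := exists_walks (π := π) hq (fun t => (hdeg t).2) m
  set μ := Measure.pi fun i => ch.law (encode π u i) with hμ
  set T := S.filter fun s => Function.Injective fun i => (s i).bit with hT
  let E : (Fin (m + 1) → Dart N) → Set (Fin (N + 1) → Y) := fun s =>
    {y | ∑ j, ch.llr (ch.unflip (encode π u (s j).bit) (y (s j).bit)) ≤ 0}
  -- The null event that some received symbol is impossible for its sent bit; outside it the signed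
  -- LLRs avoid `-∞`, as the cost argument requires.
  let Z : Set (Fin (N + 1) → Y) := ⋃ i, Function.eval i ⁻¹' {y | ch.dens (encode π u i) y = 0}
  have hZ : μ.real Z = 0 := by
    rw [measureReal_def, measure_iUnion_null, ENNReal.toReal_zero]
    intro i
    exact (measurePreserving_eval (fun i => ch.law (encode π u i)) i).quasiMeasurePreserving
      |>.preimage_null (ch.law_dens_eq_zero _)
  have hsub : {y | ralpOutput (sol y) ≠ some fun t => ((u t).val : ℝ)} ⊆ Z ∪ ⋃ s ∈ T, E s := by
    intro y hy
    by_cases hyZ : y ∈ Z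
    · exact .inl hyZ
    right
    have hdens : ∀ i, ch.dens (encode π u i) (y i) ≠ 0 := by
      intro i hi
      exact hyZ (Set.mem_iUnion.2 ⟨i, hi⟩)
    have hcost : ∀ v, offCost π u (fun i => ch.llr (y i)) v
        = ch.llr (ch.unflip (encode π u v) (y v)) := fun v => (ch.llr_unflip (hdens v)).1.symm
    obtain ⟨d, hd, hsum⟩ := exists_cheap_walk (u := u) (fun t => (hdeg t).1)
      (fun t => (hdeg t).2) (fun v => by rw [hcost]; exact (ch.llr_unflip (hdens v)).2)
      (hsol y) hy (m + 1)
    refine Set.mem_iUnion₂.2 ⟨fun i => d i, Finset.mem_filter.2 ⟨hmem d fun j hj =>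
      (hd j (by omega)).2, walk_bits_injective (fun j hj => (hd j hj).1)
      (fun j hj => (hd j hj).2) hg hm⟩, ?_⟩
    change ∑ j : Fin (m + 1), ch.llr (ch.unflip (encode π u (d j).bit) (y (d j).bit)) ≤ 0
    rw [Finset.sum_range] at hsum
    simpa only [hcost] using hsum
  have hcard : T.card ≤ 2 * (N + 1) * (2 * q - 1) ^ m := (Finset.card_filter_le _ _).trans hS
  have hnn : 0 ≤ ch.llrSumProb (m + 1) := measureReal_nonneg
  calc wordErrorProb ch π sol u ≤ μ.real (Z ∪ ⋃ s ∈ T, E s) := measureReal_mono hsub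
    _ ≤ μ.real Z + μ.real (⋃ s ∈ T, E s) := measureReal_union_le _ _
    _ ≤ 0 + ∑ s ∈ T, μ.real (E s) := by
        rw [hZ]; gcongr; exact measureReal_biUnion_finset_le _ _
    _ ≤ 0 + ∑ s ∈ T, ch.llrSumProb (m + 1) := by
        gcongr with s hs
        exact ch.measure_sum_llr_le (encode π u) (fun j => (s j).bit) (Finset.mem_filter.1 hs).2
    _ = T.card * ch.llrSumProb (m + 1) := by rw [zero_add, Finset.sum_const, nsmul_eq_mul]
    _ ≤ _ := by gcongr

theorem wordErrorProb_bound {n : ℕ} (hk : 0 < k) {deg : Fin k → ℕ}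
    (hdeg : ∀ t, Even (deg t) ∧ 0 < deg t) {π : Interleaver deg n} {g q : ℕ}
    (hg : (g : ℕ∞) ≤ auxGirth π) (hq : ∀ t, deg t ≤ q)
    {sol : (Fin n → Y) → (TrellisEdge n → ℝ) × (Fin k → ℝ)}
    (hsol : IsRALPSolver ch π sol) (u : Fin k → ZMod 2) {m : ℕ} (hm : 2 * m ≤ g) :
    wordErrorProb ch π sol u ≤ (n : ℝ) * (2 * (q : ℝ) - 1) ^ m * ch.llrSumProb m ∧
      (¬ (ch.law 0).MutuallySingular (ch.law 1) →
        wordErrorProb ch π sol u < (n : ℝ) * (2 * (q : ℝ) - 1) ^ m * ch.llrSumProb m) := by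
  have hd2 : ∀ t, 2 ≤ deg t := fun t => by
    obtain ⟨r, hr⟩ := (hdeg t).1
    have := (hdeg t).2
    omega
  have hn : 2 ≤ n := by
    have h1 : ∑ t, deg t = n := by simpa using Fintype.card_congr π
    rw [← h1]
    exact (hd2 ⟨0, hk⟩).trans (Finset.single_le_sum (fun _ _ => Nat.zero_le _)
      (Finset.mem_univ _))
  have hq2 : 2 ≤ q := (hd2 ⟨0, hk⟩).trans (hq _)
  rcases m with _ | m
  -- For `m = 0` the empty sum has probability 1, and the bound is strict because `n ≥ 2`.
  · have h1 : wordErrorProb ch π sol u < (n : ℝ) * (2 * (q : ℝ) - 1) ^ 0 * ch.llrSumProb 0 := by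
      rw [ch.llrSumProb_zero, pow_zero, mul_one, mul_one]
      refine lt_of_le_of_lt wordErrorProb_le_one ?_
      exact_mod_cast hn
    exact ⟨h1.le, fun _ => h1⟩
  · obtain ⟨N, rfl⟩ : ∃ N, n = N + 1 := ⟨n - 1, by omega⟩
    have h1 := wordErrorProb_le_card hdeg hg hq hsol u hm
    -- The two directions of the first dart cost a factor 2, which is less than `2 * q - 1 ≥ 3`.
    have h2 : ((2 * (N + 1) * (2 * q - 1) ^ m : ℕ) : ℝ)
        < ((N + 1 : ℕ) : ℝ) * (2 * (q : ℝ) - 1) ^ (m + 1) := by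
      have hqr : (2 : ℝ) ≤ q := by exact_mod_cast hq2
      have h3 : ((2 * q - 1 : ℕ) : ℝ) = 2 * (q : ℝ) - 1 := by
        rw [Nat.cast_sub (by omega)]; push_cast; ring
      push_cast [h3]
      rw [pow_succ]
      have h4 : (0 : ℝ) < (N + 1) * (2 * (q : ℝ) - 1) ^ m := by
        have : (0 : ℝ) < 2 * q - 1 := by linarith
        positivity
      nlinarith
    refine ⟨h1.trans (mul_le_mul_of_nonneg_right h2.le measureReal_nonneg), fun hs => ?_⟩
    exact h1.trans_lt (mul_lt_mul_of_pos_right h2 (ch.llrSumProb_pos hs _))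

end ErrorBound
end RACode

theorem theorem6 {Y : Type*} [MeasurableSpace Y] (ch : RACode.MBIOSChannel Y) :
    -- regular codes
    (∀ q k n : ℕ, Even q → 0 < q → 0 < k → n = q * k →
      -- interleavers of logarithmic girth exist
      (∃ π : RACode.Interleaver (fun _ : Fin k => q) n,
        ((Nat.log q n - 1 : ℕ) : ℕ∞) ≤ RACode.auxGirth π) ∧
      -- and the error bound holds for each of them
      ∀ π : RACode.Interleaver (fun _ : Fin k => q) n,
        ((Nat.log q n - 1 : ℕ) : ℕ∞) ≤ RACode.auxGirth π →
      ∀ sol, RACode.IsRALPSolver ch π sol →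
      ∀ (u : Fin k → ZMod 2) (m : ℕ), (m : ℝ) ≤ (Real.logb q n - 1) / 2 →
        RACode.wordErrorProb ch π sol u
            ≤ (n : ℝ) * (2 * (q : ℝ) - 1) ^ m * ch.llrSumProb m ∧
        (¬ (ch.law 0).MutuallySingular (ch.law 1) →
          RACode.wordErrorProb ch π sol u
            < (n : ℝ) * (2 * (q : ℝ) - 1) ^ m * ch.llrSumProb m)) ∧
    -- irregular codes with even repetition degrees
    (∀ (k n : ℕ) (deg : Fin k → ℕ), 0 < k → (∀ t, Even (deg t) ∧ 0 < deg t) →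
      ∀ (π : RACode.Interleaver deg n) (g' : ℕ), (g' : ℕ∞) ≤ RACode.auxGirth π →
      ∀ sol, RACode.IsRALPSolver ch π sol →
      ∀ (u : Fin k → ZMod 2) (m : ℕ), (m : ℝ) ≤ (g' : ℝ) / 2 →
        RACode.wordErrorProb ch π sol u
            ≤ (n : ℝ) * (2 * ((Finset.univ.sup deg : ℕ) : ℝ) - 1) ^ m * ch.llrSumProb m ∧
        (¬ (ch.law 0).MutuallySingular (ch.law 1) →
          RACode.wordErrorProb ch π sol u
            < (n : ℝ) * (2 * ((Finset.univ.sup deg : ℕ) : ℝ) - 1) ^ m * ch.llrSumProb m)) := by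
  refine ⟨fun q k n hqe hq hk hn => ?_, fun k n deg hk hdeg π g' hg sol hsol u m hm => ?_⟩
  · have hq2 : 2 ≤ q := by
      obtain ⟨r, hr⟩ := hqe
      omega
    refine ⟨RACode.exists_interleaver q k n hq2 hk hn, fun π hg sol hsol u m hm => ?_⟩
    refine RACode.wordErrorProb_bound hk (fun _ => ⟨hqe, hq⟩) hg (fun _ => le_rfl) hsol u ?_
    have hn0 : n ≠ 0 := by rw [hn]; positivity
    -- Since `2 * m + 1` is an integer, the bound by the real logarithm passes to its floor.
    have h1 : 2 * m + 1 ≤ Nat.log q n := by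
      refine Nat.le_log_of_pow_le (by omega) ?_
      have h2 : ((2 * m + 1 : ℕ) : ℝ) ≤ Real.logb q n := by push_cast; linarith
      rw [Real.le_logb_iff_rpow_le (by exact_mod_cast hq2) (by positivity),
        Real.rpow_natCast] at h2
      exact_mod_cast h2
    omega
  · refine RACode.wordErrorProb_bound hk hdeg hg
      (fun t => Finset.le_sup (f := deg) (Finset.mem_univ t)) hsol u ?_
    have h2 : ((2 * m : ℕ) : ℝ) ≤ g' := by push_cast; linarith
    exact_mod_cast h2
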